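/- Let $T$ be a complete first-order theory with NIP (no formula $\varphi(\bar x,\bar y)$, $\bar x,\bar y$ finite tuples of variables, has the independence property), let $|T|=|L(T)|$ be the number of formulas of its language (so $|T|\ge\aleph_0$), and let $\mathfrak C$ be a monster model of $T$: for some cardinal $\bar\kappa>|T|$, $\mathfrak C$ is $\bar\kappa$-saturated and strongly $\bar\kappa$-homogeneous. All sequences below are sequences $\bar{\mathbf a}=\langle \bar a_t:t\in I\rangle$ of finite tuples of $\mathfrak C$ of one fixed length $m$ (possibly different for different sequences), indexed by linear orders $I$ with $|I|<\bar\kappa$; $\bar{\mathbf a}$ is endless if $I$ is non-empty without last element. We identify $\bar{\mathbf a}$ with the set of entries of its tuples when it serves as a set of parameters. Definitions. Two sequences are mutually indiscernible if each of them is indiscernible over the other. For an endless $\bar{\mathbf a}$, $\mathrm{Av}(A,\bar{\mathbf a})$ is the set of all formulas $\varphi(\bar x,\bar c)$, $\bar c$ from $A$, with $\mathfrak C\models\varphi(\bar a_t,\bar c)$ for every large enough $t\in I$. Endless indiscernible sequences $\bar{\mathbf a}^1,\bar{\mathbf a}^2$ (of tuples of the same length) are equivalent if $\mathrm{Av}(A,\bar{\mathbf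 a}^1)=\mathrm{Av}(A,\bar{\mathbf a}^2)$ for every $A\subseteq\mathfrak C$. For a well-ordered set $N$, sequences $\bar{\mathbf b}^\ell=\langle\bar b^\ell_\alpha:\alpha\in N\rangle$ ($\ell=1,2$) are built from averages of $(\bar{\mathbf a}^1,\bar{\mathbf a}^2)$ if for all $\alpha\in N$ and $\ell\in\{1,2\}$, $\bar b^\ell_\alpha$ realizes $$\mathrm{Av}\bigl(\{\bar b^k_\beta:\beta<\alpha,\ k\in\{1,2\},\ \text{or } \beta=\alpha,\ k<\ell\}\cup\bar{\mathbf a}^1\cup\bar{\mathbf a}^2,\ \bar{\mathbf a}^\ell\bigr).$$ Endless indiscernible sequences $\bar{\mathbf a}^1,\bar{\mathbf a}^2$ are perpendicular if all $\bar{\mathbf b}^1,\bar{\mathbf b}^2$ indexed by $\omega$ and built from averages of $(\bar{\mathbf a}^1,\bar{\mathbf a}^2)$ are mutually indiscernible. Then: (A1) Endless mutually indiscernible sequences are perpendicular. (A2) "Mutually indiscernible" and, for endless indiscernible sequences, "perpendicular" are symmetric relations. (A3) "Equivalent" is an equivalence relation on the family of endless indiscernible sequences. (B1) If $\bar{\mathbf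 a}^\ell$ is an indiscernible sequence indexed by $I_\ell$ ($\ell=1,2$), $|T|<\mathrm{cf}(I_1)$ and $|I_1|<\mathrm{cf}(I_2)$, then for some (non-empty) end segments $J_1,J_2$ of $I_1,I_2$ respectively, $\bar{\mathbf a}^1\restriction J_1$ and $\bar{\mathbf a}^2\restriction J_2$ are mutually indiscernible. (B2) If $\bar{\mathbf a}^\ell$ is an indiscernible sequence indexed by $I_\ell$ ($\ell=1,2$) and $\mathrm{cf}(I_1),\mathrm{cf}(I_2)$ are infinite and distinct, then $\bar{\mathbf a}^1,\bar{\mathbf a}^2$ are perpendicular. (B3) If $\bar{\mathbf a}^1,\bar{\mathbf a}^2$ are endless indiscernible sequences, $\delta$ is a limit ordinal with $|\delta|<\bar\kappa$, and $\bar{\mathbf b}^1,\bar{\mathbf b}^2$, indexed by $\delta$, are built from averages of $(\bar{\mathbf a}^1,\bar{\mathbf a}^2)$, then $\bar{\mathbf b}^1,\bar{\mathbf b}^2$ are endless indiscernible sequences, and $\bar{\mathbf a}^1,\bar{\mathbf a}^2$ are perpendicular iff $\bar{\mathbf b}^1,\bar{\mathbf b}^2$ are perpendicular. (B4) If $\bar{\mathbf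 a}^\ell$ is an endless indiscernible sequence indexed by $I_\ell$ and $J_\ell\subseteq I_\ell$ is unbounded ($\ell=1,2$), then $\bar{\mathbf a}^1,\bar{\mathbf a}^2$ are perpendicular iff $\bar{\mathbf a}^1\restriction J_1,\bar{\mathbf a}^2\restriction J_2$ are perpendicular. (B5) If $\bar{\mathbf a}^1,\bar{\mathbf a}^2,\bar{\mathbf a}^3,\bar{\mathbf a}^4$ are endless indiscernible sequences, $\bar{\mathbf a}^1,\bar{\mathbf a}^3$ are equivalent and $\bar{\mathbf a}^2,\bar{\mathbf a}^4$ are equivalent, then $\bar{\mathbf a}^1,\bar{\mathbf a}^2$ are perpendicular iff $\bar{\mathbf a}^3,\bar{\mathbf a}^4$ are perpendicular. -/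

import Mathlib

open Cardinal
open scoped FirstOrder

universe u v w

namespace NIPSeq

section

variable (L : FirstOrder.Language.{u, v}) {M : Type w} [L.Structure M]

/-- `|T|`, the number of formulas of the language of `T`. -/
noncomputable def theoryCard (L : FirstOrder.Language.{u, v}) : Cardinal.{max u v} :=
  max ℵ₀ L.card

/-- `M` is `κ`-saturated: every finitely satisfiable set of formulas in finitely many variables with
parameters from a set of size `< κ` is realized. A formula over `A` is a formula whose free
variables are either object variables or names of elements of `A`. -/
def IsSaturated (M : Type w) [L.Structure M] (κ : Cardinal.{w}) : Prop :=
  ∀ (A : Set M), #A < κ → ∀ (n : ℕ) (p : Set (L.Formula (A ⊕ Fin n))),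
    (∀ q : Finset (L.Formula (A ⊕ Fin n)), (q : Set (L.Formula (A ⊕ Fin n))) ⊆ p →
      ∃ v : Fin n → M, ∀ φ ∈ q, φ.Realize (Sum.elim (fun x : A => (x : M)) v)) →
    ∃ v : Fin n → M, ∀ φ ∈ p, φ.Realize (Sum.elim (fun x : A => (x : M)) v)

/-- `M` is strongly `κ`-homogeneous: every elementary map from a set of size `< κ` to `M` extends to
an automorphism of `M`. -/
def IsStronglyHomogeneous (M : Type w) [L.Structure M] (κ : Cardinal.{w}) : Prop :=
  ∀ (A : Set M), #A < κ → ∀ f : A → M,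
    (∀ φ : L.Formula A, φ.Realize (fun x : A => (x : M)) ↔ φ.Realize f) →
    ∃ g : M ≃[L] M, ∀ x : A, g x = f x

/-- `M` is a monster model of the complete theory `T`, "small" meaning "of size `< κ`". -/
structure IsMonster (T : L.Theory) (M : Type w) [L.Structure M] (κ : Cardinal.{w}) : Prop where
  complete : T.IsComplete
  nonempty : Nonempty M
  models : M ⊨ T
  card_lt : lift.{w} (theoryCard L) < lift.{max u v} κ
  saturated : IsSaturated L M κ
  homogeneous : IsStronglyHomogeneous L M κ

/-- `φ(x̄, ȳ)` has the independence property in `M`: for every `n` there are `ȳ₀, …, ȳₙ₋₁` such that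
every pattern `η ∈ ⁿ2` is realized by some `x̄`. -/
def HasIP (M : Type w) [L.Structure M] {j k : ℕ} (φ : L.Formula (Fin j ⊕ Fin k)) : Prop :=
  ∀ n : ℕ, ∃ y : Fin n → Fin k → M, ∀ η : Fin n → Bool, ∃ x : Fin j → M,
    ∀ l : Fin n, φ.Realize (Sum.elim x (y l)) ↔ η l = true

/-- The complete theory of `M` does not have the independence property. -/
def NIP (M : Type w) [L.Structure M] : Prop :=
  ∀ (j k : ℕ) (φ : L.Formula (Fin j ⊕ Fin k)), ¬ HasIP L M φ

/-- The set of all entries of the tuples in the sequence `a`. -/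
def entries {I : Type*} {m : ℕ} (a : I → Fin m → M) : Set M :=
  ⋃ t, Set.range (a t)

/-- The sequence `a` of `m`-tuples is an indiscernible sequence over `A`. -/
def IndiscernibleOver (A : Set M) {I : Type*} [LinearOrder I] {m : ℕ} (a : I → Fin m → M) : Prop :=
  ∀ (n : ℕ) (φ : L.Formula (A ⊕ (Fin n × Fin m))) (s t : Fin n → I), StrictMono s → StrictMono t →
    (φ.Realize (Sum.elim (fun x : A => (x : M)) fun p => a (s p.1) p.2) ↔
      φ.Realize (Sum.elim (fun x : A => (x : M)) fun p => a (t p.1) p.2))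

/-- A small indiscernible sequence. -/
def IsIndiscernibleSeq (κ : Cardinal.{w}) {I : Type w} [LinearOrder I] {m : ℕ}
    (a : I → Fin m → M) : Prop :=
  #I < κ ∧ IndiscernibleOver L ∅ a

/-- A small endless indiscernible sequence: the index set has no last element. -/
def IsEndlessIndiscernible (κ : Cardinal.{w}) {I : Type w} [LinearOrder I] {m : ℕ}
    (a : I → Fin m → M) : Prop :=
  Nonempty I ∧ NoMaxOrder I ∧ IsIndiscernibleSeq L κ a

/-- Each of the two sequences is indiscernible over the other one. -/
def MutuallyIndiscernible {I₁ I₂ : Type*} [LinearOrder I₁] [LinearOrder I₂] {m₁ m₂ : ℕ}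
    (b₁ : I₁ → Fin m₁ → M) (b₂ : I₂ → Fin m₂ → M) : Prop :=
  IndiscernibleOver L (entries b₂) b₁ ∧ IndiscernibleOver L (entries b₁) b₂

/-- The average `Av(A, a)`: all formulas `φ(x̄)` over `A` that hold at `a t` for every large
enough `t`. -/
def Av (A : Set M) {I : Type*} [LinearOrder I] {m : ℕ} (a : I → Fin m → M) :
    Set (L.Formula (A ⊕ Fin m)) :=
  {φ | ∀ᶠ t in Filter.atTop, φ.Realize (Sum.elim (fun x : A => (x : M)) (a t))}

/-- The tuple `b` realizes the average `Av(A, a)`. -/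
def RealizesAv (A : Set M) {I : Type*} [LinearOrder I] {m : ℕ} (a : I → Fin m → M)
    (b : Fin m → M) : Prop :=
  ∀ φ ∈ Av L A a, φ.Realize (Sum.elim (fun x : A => (x : M)) b)

/-- All the entries of `a₁`, of `a₂`, and of the tuples `b₁ β`, `b₂ β` for `β < α`. -/
def base {I₁ I₂ N : Type*} [LT N] {m₁ m₂ : ℕ}
    (a₁ : I₁ → Fin m₁ → M) (a₂ : I₂ → Fin m₂ → M)
    (b₁ : N → Fin m₁ → M) (b₂ : N → Fin m₂ → M) (α : N) : Set M :=
  entries a₁ ∪ entries a₂ ∪ ⋃ β : {β : N // β < α}, Set.range (b₁ β) ∪ Set.range (b₂ β)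

/-- `(b₁, b₂)` is built by alternately realizing averages of `a₁` and `a₂` over everything chosen
before, in the order `b₁ 0, b₂ 0, b₁ 1, b₂ 1, …`. -/
def BuiltFromAverages {I₁ I₂ N : Type*} [LinearOrder I₁] [LinearOrder I₂] [LT N] {m₁ m₂ : ℕ}
    (a₁ : I₁ → Fin m₁ → M) (a₂ : I₂ → Fin m₂ → M)
    (b₁ : N → Fin m₁ → M) (b₂ : N → Fin m₂ → M) : Prop :=
  ∀ α : N, RealizesAv L (base a₁ a₂ b₁ b₂ α) a₁ (b₁ α) ∧
    RealizesAv L (base a₁ a₂ b₁ b₂ α ∪ Set.range (b₁ α)) a₂ (b₂ α)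

/-- Perpendicularity of two endless indiscernible sequences. -/
def Perpendicular {I₁ I₂ : Type*} [LinearOrder I₁] [LinearOrder I₂] {m₁ m₂ : ℕ}
    (a₁ : I₁ → Fin m₁ → M) (a₂ : I₂ → Fin m₂ → M) : Prop :=
  ∀ (b₁ : ℕ → Fin m₁ → M) (b₂ : ℕ → Fin m₂ → M),
    BuiltFromAverages L a₁ a₂ b₁ b₂ → MutuallyIndiscernible L b₁ b₂

/-- Two endless indiscernible sequences are equivalent if they have the same averages over every
set. -/
def Equivalent {I₁ I₂ : Type*} [LinearOrder I₁] [LinearOrder I₂] {m : ℕ}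
    (a₁ : I₁ → Fin m → M) (a₂ : I₂ → Fin m → M) : Prop :=
  ∀ A : Set M, Av L A a₁ = Av L A a₂

/-- `J` is an end segment of `I`. -/
def IsEndSegment {I : Type*} [LinearOrder I] (J : Set I) : Prop :=
  J.Nonempty ∧ IsUpperSet J

end

end NIPSeq

/-! Everything rests on one substitution principle. Under NIP the truth value of a formula with
parameters is eventually constant along an indiscernible sequence (`eventually_const`): if it kept
alternating, indiscernibility would produce every pattern on successive blocks of the sequence. So
averages are complete types, and in a given formula a realization of an average may be replaced by
any member of large enough index. In a pair built from averages, the tuple chosen last is replaced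
first, since everything else in the formula is then a parameter over which it realizes the average
(`GenericOver.exists_realize_iff`). Tuples chosen earlier thus receive larger indices, and
increasing tuples turn into decreasing ones.

Two built pairs can be replaced simultaneously by the same members. Hence the truth of a formula on
a built pair depends only on the relative order of the indices (`BuiltFromAverages.realize_iff`),
and perpendicularity can be tested on a single pair (`perpendicular_of_built`). Symmetry follows by
shifting one sequence of such a pair, invariance under equivalence by building one pair over all
four sequences, and mutual indiscernibility passes from the original sequences to any built pair. A
pair built from averages of a built pair is, read backwards, again of the original kind
(`BuiltFromAverages.realize_iff_reverse`), which gives the statement about limit ordinals.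

For cofinalities: if `#I₁ < cof I₂`, the thresholds in `I₂` for all parameters from the first
sequence have a common bound, so each formula is constant on a pair of end segments
(`exists_forall_realize_iff`). If `|T| < cof I₁` as well, the end segments can be chosen for all
formulas at once. For perpendicularity one formula at a time is enough, and `I₁` may first be
thinned to a cofinal subset of size `cof I₁`. -/

namespace NIPSeq

section

variable {L : FirstOrder.Language.{u, v}} {M : Type w} [L.Structure M]

open FirstOrder.Language

/-! ### NIP and truth values along indiscernible sequences -/

/-- A formula only depends on finitely many of its variables. -/
theorem exists_restrict {α : Type*} (φ : L.Formula α) :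
    ∃ (s : Finset α) (ψ : L.Formula s), ∀ v : α → M, φ.Realize v ↔ ψ.Realize fun x => v x := by
  classical
  exact ⟨φ.freeVarFinset, φ.restrictFreeVar id, fun v =>
    (BoundedFormula.realize_restrictFreeVar (φ := φ) (f := id) (v := fun x => v x) v
      (by simp)).symm⟩

/-- Allowing any finite linear order `K` in place of `Fin n` makes lexicographic products
(concatenated blocks) and order duals (decreasing tuples) available later. -/
theorem IndiscernibleOver.realize_iff {A : Set M} {I : Type*} [LinearOrder I] {m : ℕ}
    {a : I → Fin m → M} (ha : IndiscernibleOver L A a) {K : Type*} [LinearOrder K] [Finite K]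
    {β : Type*} (φ : L.Formula (β ⊕ K × Fin m)) (c : β → M) (hc : ∀ x, c x ∈ A) {s t : K → I}
    (hs : StrictMono s) (ht : StrictMono t) :
    φ.Realize (Sum.elim c fun p => a (s p.1) p.2) ↔
      φ.Realize (Sum.elim c fun p => a (t p.1) p.2) := by
  classical
  have := Fintype.ofFinite K
  let e : Fin (Fintype.card K) ≃o K := Fintype.orderIsoFinOfCardEq K rfl
  have h := ha _ (φ.relabel (Sum.map (fun x => (⟨c x, hc x⟩ : A)) (Prod.map e.symm id)))
    (s ∘ e) (t ∘ e) (hs.comp e.strictMono) (ht.comp e.strictMono)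
  simp only [Formula.realize_relabel] at h
  convert h using 2 <;> (ext x; rcases x with x | x <;> simp)

theorem IndiscernibleOver.realize_iff_of_empty {I : Type*} [LinearOrder I] {m : ℕ}
    {a : I → Fin m → M} (ha : IndiscernibleOver L ∅ a) {K : Type*} [LinearOrder K] [Finite K]
    (φ : L.Formula (K × Fin m)) {s t : K → I} (hs : StrictMono s) (ht : StrictMono t) :
    (φ.Realize fun p => a (s p.1) p.2) ↔ φ.Realize fun p => a (t p.1) p.2 := by
  have h := ha.realize_iff (β := Empty) (φ.relabel Sum.inr) Empty.elim (by simp) hs ht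
  simpa only [Formula.realize_relabel, Sum.elim_comp_inr] using h

/-- The NIP dichotomy, for parameters indexed by an initial segment of the natural numbers. -/
theorem eventually_const_of_fin (hN : NIP L M) {I : Type*} [LinearOrder I] [Nonempty I]
    {m : ℕ} {a : I → Fin m → M} (ha : IndiscernibleOver L ∅ a) {j n : ℕ}
    (φ : L.Formula (Fin j ⊕ Fin n × Fin m)) (c : Fin j → M) :
    ∃ T : I, ∀ s t : Fin n → I, StrictMono s → StrictMono t → (∀ i, T < s i) → (∀ i, T < t i) →
      (φ.Realize (Sum.elim c fun p => a (s p.1) p.2) →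
        φ.Realize (Sum.elim c fun p => a (t p.1) p.2)) := by
  by_contra! hcon
  -- Beyond every `T` there is a tuple `u T true` satisfying the formula and a tuple `u T false`
  -- refuting it.
  have h1 : ∀ T : I, ∃ u : Bool → Fin n → I, ∀ b, StrictMono (u b) ∧ (∀ i, T < u b i) ∧
      (φ.Realize (Sum.elim c fun p => a (u b p.1) p.2) ↔ b = true) := by
    intro T
    obtain ⟨s, t, hs, ht, hTs, hTt, h, h'⟩ := hcon T
    refine ⟨fun b => cond b s t, ?_⟩
    rintro (_ | _)
    · exact ⟨ht, hTt, by simpa using h'⟩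
    · exact ⟨hs, hTs, by simpa using h⟩
  choose u hu using h1
  have h2 : ∀ T : I, ∃ T', ∀ b i, u T b i ≤ T' := by
    intro T
    obtain ⟨T', hT'⟩ := (Set.finite_range fun p : Bool × Fin n => u T p.1 p.2).bddAbove
    exact ⟨T', fun b i => hT' ⟨(b, i), rfl⟩⟩
  choose f hf using h2
  -- Each iterate passes both tuples of the previous stage, so the blocks `u (T k)` follow one
  -- another whichever of the two is taken in each.
  let T : ℕ → I := fun k => f^[k] (Classical.arbitrary I)
  have hT : ∀ k, T (k + 1) = f (T k) := fun k => Function.iterate_succ_apply' _ _ _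
  have hlt : ∀ k l, k < l → ∀ b b' i i', u (T k) b i < u (T l) b' i' := by
    intro k l hkl b b' i i'
    have h3 : T (k + 1) ≤ T l := by
      by_cases hn : Nonempty (Fin n)
      · have : Monotone T := monotone_nat_of_le_succ fun k => by
          rw [hT]
          exact ((hu (T k) b).2.1 i).le.trans (hf _ b i)
        exact this hkl
      · exact (hn ⟨i⟩).elim
    exact ((hf _ b i).trans_eq (hT k).symm).trans_lt (h3.trans_lt ((hu _ b').2.1 i'))
  -- The parameters witnessing the independence property are the blocks `u (T l) true`.
  refine hN j (n * m) (φ.relabel (Sum.map id finProdFinEquiv)) fun N =>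
    ⟨fun l q => a (u (T l) true (finProdFinEquiv.symm q).1) (finProdFinEquiv.symm q).2, ?_⟩
  intro η
  -- The concatenation of the `N` blocks, with the version in block `l` chosen by `η l`. On it `c`
  -- itself realizes the pattern `η`; that some tuple does so is a formula `ψ` about the blocks,
  -- which indiscernibility transfers to the blocks of constant value `true`.
  let S : (Fin N → Bool) → (Fin N ×ₗ Fin n) → I := fun η p =>
    u (T (ofLex p).1) (η (ofLex p).1) (ofLex p).2
  have hS : ∀ η, StrictMono (S η) := by
    intro η p q hpq
    rcases Prod.Lex.lt_iff.1 hpq with h | ⟨h, h'⟩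
    · exact hlt _ _ h _ _ _ _
    · simp only [S, h]
      exact (hu _ _).1 h'
  let χ : Fin N → L.Formula (((Fin N ×ₗ Fin n) × Fin m) ⊕ Fin j) := fun l =>
    φ.relabel (Sum.elim Sum.inr fun p => Sum.inl (toLex (l, p.1), p.2))
  let ψ : L.Formula ((Fin N ×ₗ Fin n) × Fin m) :=
    Formula.iExs (Fin j) (Formula.iInf fun l => if η l then χ l else (χ l).not)
  have hψ : ∀ η', (ψ.Realize fun p => a (S η' p.1) p.2) ↔ ∃ x : Fin j → M, ∀ l,
      φ.Realize (Sum.elim x fun p => a (S η' (toLex (l, p.1))) p.2) ↔ η l = true := by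
    intro η'
    have key : ∀ (x : Fin j → M) l, (χ l).Realize (Sum.elim (fun p => a (S η' p.1) p.2) x) ↔
        φ.Realize (Sum.elim x fun p => a (S η' (toLex (l, p.1))) p.2) := by
      intro x l
      simp only [χ, Formula.realize_relabel]
      apply iff_of_eq
      congr 1
      ext z
      rcases z with z | z <;> rfl
    simp only [ψ, Formula.realize_iExs]
    refine exists_congr fun x => ?_
    rw [Formula.realize_iInf]
    refine forall_congr' fun l => ?_
    rw [← key]
    cases η l <;> simp
  have := (ha.realize_iff_of_empty ψ (hS η) (hS fun _ => true)).1 ((hψ η).2 ⟨c, fun l => by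
    simpa [S] using (hu (T l) (η l)).2.2⟩)
  obtain ⟨x, hx⟩ := (hψ fun _ => true).1 this
  refine ⟨x, fun l => ?_⟩
  rw [← hx l, Formula.realize_relabel]
  apply iff_of_eq
  congr 1
  ext z
  rcases z with z | z <;> simp [S, -finProdFinEquiv_symm_apply]

/-- In a theory with NIP, the truth value of a formula with parameters is constant on increasing
tuples from an end segment of an endless indiscernible sequence. -/
theorem eventually_const (hN : NIP L M) {I : Type*} [LinearOrder I] [Nonempty I]
    {m : ℕ} {a : I → Fin m → M} (ha : IndiscernibleOver L ∅ a) {C : Type*} {n : ℕ}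
    (φ : L.Formula (C ⊕ Fin n × Fin m)) (c : C → M) :
    ∃ T : I, ∀ s t : Fin n → I, StrictMono s → StrictMono t → (∀ i, T < s i) → (∀ i, T < t i) →
      (φ.Realize (Sum.elim c fun p => a (s p.1) p.2) ↔
        φ.Realize (Sum.elim c fun p => a (t p.1) p.2)) := by
  classical
  obtain ⟨S, ψ, hψ⟩ := exists_restrict (M := M) φ
  let e := (Finset.equivFin S.toLeft)
  obtain ⟨T, hT⟩ := eventually_const_of_fin hN ha (ψ.relabel fun z : S => match z with
    | ⟨Sum.inl x, hx⟩ => Sum.inl (e ⟨x, by simpa using hx⟩)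
    | ⟨Sum.inr x, _⟩ => Sum.inr x) (fun i => c (e.symm i))
  have key : ∀ s : Fin n → I, φ.Realize (Sum.elim c fun p => a (s p.1) p.2) ↔
      (ψ.relabel fun z : S => match z with
    | ⟨Sum.inl x, hx⟩ => Sum.inl (e ⟨x, by simpa using hx⟩)
    | ⟨Sum.inr x, _⟩ => Sum.inr x).Realize
      (Sum.elim (fun i => c (e.symm i)) fun p => a (s p.1) p.2) := by
    intro s
    rw [hψ, Formula.realize_relabel]
    apply iff_of_eq
    congr 1
    ext z
    rcases z with ⟨z | z, hz⟩ <;> simp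
  refine ⟨T, fun s t hs ht hTs hTt => ?_⟩
  rw [key, key]
  exact ⟨hT s t hs ht hTs hTt, hT t s ht hs hTt hTs⟩

/-- The formulas over a set are decided by the tuples of large enough index. -/
theorem eventually_or (hN : NIP L M) {I : Type*} [LinearOrder I] [Nonempty I] [NoMaxOrder I]
    {m : ℕ} {a : I → Fin m → M} (ha : IndiscernibleOver L ∅ a) {C : Type*}
    (φ : L.Formula (C ⊕ Fin m)) (c : C → M) :
    (∀ᶠ t in Filter.atTop, φ.Realize (Sum.elim c (a t))) ∨
      ∀ᶠ t in Filter.atTop, ¬ φ.Realize (Sum.elim c (a t)) := by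
  obtain ⟨T, hT⟩ := eventually_const hN ha (n := 1) (φ.relabel (Sum.map id fun i => (0, i))) c
  have key : ∀ s t, T < s → T < t →
      (φ.Realize (Sum.elim c (a s)) ↔ φ.Realize (Sum.elim c (a t))) := by
    intro s t hs ht
    have := hT (fun _ => s) (fun _ => t) (Subsingleton.strictMono _) (Subsingleton.strictMono _)
      (fun _ => hs) (fun _ => ht)
    rwa [Formula.realize_relabel, Formula.realize_relabel, Sum.elim_comp_map, Sum.elim_comp_map]
      at this
  obtain ⟨T', hT'⟩ := exists_gt T
  by_cases h : φ.Realize (Sum.elim c (a T'))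
  · exact .inl ((Filter.eventually_gt_atTop T).mono fun t ht => (key T' t hT' ht).1 h)
  · exact .inr ((Filter.eventually_gt_atTop T).mono fun t ht => mt (key T' t hT' ht).2 h)

end

/-! ### Replacing realizations of averages by members of the sequences -/

/-- Substitution, one at a time and beginning with the element of largest rank. -/
theorem exists_substitution {K R : Type*} [DecidableEq K] [Finite K] [LinearOrder R]
    {r : K → R} (hr : Function.Injective r) {X : K → Type*} (F : ∀ k, Filter (X k))
    [∀ k, (F k).NeBot] (G : ∀ k, X k → Prop) (E : ∀ j k, X j → X k → Prop)
    (hG : ∀ k, ∀ᶠ x in F k, G k x) (hE : ∀ j k x, ∀ᶠ y in F k, E j k x y)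
    (Q Q' : Finset K → (∀ k, X k) → Prop)
    (hQ : ∀ k S τ, k ∉ S → (∀ j ∈ S, r j < r k) →
      ∀ᶠ x in F k, (Q (insert k S) τ ↔ Q S (Function.update τ k x)))
    (hQ' : ∀ k S τ, k ∉ S → (∀ j ∈ S, r j < r k) →
      ∀ᶠ x in F k, (Q' (insert k S) τ ↔ Q' S (Function.update τ k x)))
    (S : Finset K) (τ : ∀ k, X k) :
    ∃ τ' : ∀ k, X k, (∀ k ∉ S, τ' k = τ k) ∧ (∀ k ∈ S, G k (τ' k)) ∧
      (∀ k ∈ S, ∀ j, r k < r j → E j k (τ' j) (τ' k)) ∧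
      (Q S τ ↔ Q ∅ τ') ∧ (Q' S τ ↔ Q' ∅ τ') := by
  induction S using Finset.induction_on_max_value r generalizing τ with
  | empty => exact ⟨τ, by simp⟩
  | insert k S hk hmax ih =>
    have hlt : ∀ j ∈ S, r j < r k := fun j hj =>
      (hmax j hj).lt_of_ne fun h => hk (hr h ▸ hj)
    -- Both equivalences are met by the same `x`, so that two families can later be replaced by the
    -- same members. The condition `E j k` is imposed for every `j`, but used only when `j` has
    -- larger rank and `τ j` is already final.
    obtain ⟨x, hGx, hEx, hx, hx'⟩ := ((hG k).and ((Filter.eventually_all.2 fun j =>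
      hE j k (τ j)).and ((hQ k S τ hk hlt).and (hQ' k S τ hk hlt)))).exists
    obtain ⟨τ', h1, h2, h3, h4, h5⟩ := ih (Function.update τ k x)
    refine ⟨τ', fun j hj => ?_, fun j hj => ?_, fun i hi j hij => ?_, hx.trans h4, hx'.trans h5⟩
    · rw [Finset.mem_insert, not_or] at hj
      rw [h1 j hj.2, Function.update_of_ne hj.1]
    · rcases Finset.mem_insert.1 hj with rfl | hj
      · rwa [h1 j hk, Function.update_self]
      · exact h2 j hj
    · rcases Finset.mem_insert.1 hi with rfl | hi
      · have hj : j ∉ S := fun hj => (hlt j hj).not_gt hij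
        have hji : j ≠ i := by rintro rfl; exact lt_irrefl _ hij
        rw [h1 i hk, h1 j hj, Function.update_self, Function.update_of_ne hji]
        exact hEx j
      · exact h3 i hi j hij

section

variable {L : FirstOrder.Language.{u, v}} {M : Type w} [L.Structure M]

open FirstOrder.Language

/-- A tuple realizing the average of a sequence over `A` has the same type over `A` as the members
of the sequence of large enough index, one formula at a time. -/
theorem RealizesAv.eventually_iff (hN : NIP L M) {A : Set M} {I : Type*} [LinearOrder I]
    [Nonempty I] [NoMaxOrder I] {m : ℕ} {a : I → Fin m → M} (ha : IndiscernibleOver L ∅ a)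
    {b : Fin m → M} (hb : RealizesAv L A a b) {α : Type*} (φ : L.Formula α) (f : α → M)
    (g : I → α → M)
    (h : ∀ z, (f z ∈ A ∧ ∀ t, g t z = f z) ∨ ∃ j, f z = b j ∧ ∀ t, g t z = a t j) :
    ∀ᶠ t in Filter.atTop, (φ.Realize f ↔ φ.Realize (g t)) := by
  have h' : ∀ z, ∃ x : A ⊕ Fin m, f z = Sum.elim (fun x : A => (x : M)) b x ∧
      ∀ t, g t z = Sum.elim (fun x : A => (x : M)) (a t) x := by
    intro z
    rcases h z with ⟨h1, h2⟩ | ⟨j, h1, h2⟩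
    · exact ⟨.inl ⟨f z, h1⟩, rfl, h2⟩
    · exact ⟨.inr j, h1, h2⟩
  choose p hp hp' using h'
  have e1 : φ.Realize f ↔ (φ.relabel p).Realize (Sum.elim (fun x : A => (x : M)) b) := by
    rw [Formula.realize_relabel]
    exact iff_of_eq (congrArg _ (funext hp))
  have e2 : ∀ t, φ.Realize (g t) ↔
      (φ.relabel p).Realize (Sum.elim (fun x : A => (x : M)) (a t)) := by
    intro t
    rw [Formula.realize_relabel]
    exact iff_of_eq (congrArg _ (funext fun z => hp' z t))
  simp only [e1, e2]
  -- Either the formula or its negation belongs to the average.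
  rcases eventually_or hN ha (φ.relabel p) (fun x : A => (x : M)) with h3 | h3
  · exact h3.mono fun t ht => iff_of_true (hb _ h3) ht
  · refine h3.mono fun t ht => iff_of_false ?_ ht
    have := hb (φ.relabel p).not (h3.mono fun t ht => Formula.realize_not.2 ht)
    exact Formula.realize_not.1 this

theorem RealizesAv.mono {A B : Set M} {I : Type*} [LinearOrder I] {m : ℕ} {a : I → Fin m → M}
    {b : Fin m → M} (hb : RealizesAv L B a b) (hAB : A ⊆ B) : RealizesAv L A a b := by
  intro φ hφ
  have := hb (φ.relabel (Sum.map (Set.inclusion hAB) id)) (by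
    refine Filter.Eventually.mono hφ fun t ht => ?_
    rwa [Formula.realize_relabel, Sum.elim_comp_map])
  rwa [Formula.realize_relabel, Sum.elim_comp_map] at this

/-- The assignment to the variables `(K₁ × Fin m₁) ⊕ (K₂ × Fin m₂)` given by two families of
tuples. -/
def pairVal {K₁ K₂ : Type*} {m₁ m₂ : ℕ} (x : K₁ → Fin m₁ → M) (y : K₂ → Fin m₂ → M) :
    (K₁ × Fin m₁) ⊕ (K₂ × Fin m₂) → M :=
  Sum.elim (fun p => x p.1 p.2) fun p => y p.1 p.2

/-- Two families of tuples, ranked by a linear order, such that each tuple realizes the average of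
its sequence over `A` and the tuples of smaller rank. -/
def GenericOver (L : FirstOrder.Language.{u, v}) {M : Type w} [L.Structure M] (A : Set M)
    {I₁ I₂ K₁ K₂ R : Type*} [LinearOrder I₁] [LinearOrder I₂]
    [LinearOrder R] {m₁ m₂ : ℕ} (a₁ : I₁ → Fin m₁ → M) (a₂ : I₂ → Fin m₂ → M)
    (r₁ : K₁ → R) (r₂ : K₂ → R) (c₁ : K₁ → Fin m₁ → M) (c₂ : K₂ → Fin m₂ → M) : Prop :=
  (∀ k, RealizesAv L (A ∪ {x | ∃ i, r₁ i < r₁ k ∧ x ∈ Set.range (c₁ i)} ∪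
      {x | ∃ j, r₂ j < r₁ k ∧ x ∈ Set.range (c₂ j)}) a₁ (c₁ k)) ∧
  ∀ k, RealizesAv L (A ∪ {x | ∃ i, r₁ i < r₂ k ∧ x ∈ Set.range (c₁ i)} ∪
      {x | ∃ j, r₂ j < r₂ k ∧ x ∈ Set.range (c₂ j)}) a₂ (c₂ k)

/-- If fewer elements have smaller rank, the averages are realized over smaller sets. This lets two
families with different index sets be ranked alike, as the simultaneous substitution requires. -/
theorem GenericOver.congr_rank {A : Set M} {I₁ I₂ K₁ K₂ R R' : Type*} [LinearOrder I₁]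
    [LinearOrder I₂] [LinearOrder R] [LinearOrder R'] {m₁ m₂ : ℕ} {a₁ : I₁ → Fin m₁ → M}
    {a₂ : I₂ → Fin m₂ → M} {r₁ : K₁ → R} {r₂ : K₂ → R} {c₁ : K₁ → Fin m₁ → M}
    {c₂ : K₂ → Fin m₂ → M} (h : GenericOver L A a₁ a₂ r₁ r₂ c₁ c₂) {r₁' : K₁ → R'} {r₂' : K₂ → R'}
    (hr : ∀ x y, Sum.elim r₁' r₂' x < Sum.elim r₁' r₂' y → Sum.elim r₁ r₂ x < Sum.elim r₁ r₂ y) :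
    GenericOver L A a₁ a₂ r₁' r₂' c₁ c₂ := by
  refine ⟨fun k => (h.1 k).mono ?_, fun k => (h.2 k).mono ?_⟩ <;>
  refine Set.union_subset_union (Set.union_subset_union_right _ ?_) ?_ <;>
  rintro x ⟨i, hi, hx⟩
  · exact ⟨i, hr (.inl i) (.inl k) hi, hx⟩
  · exact ⟨i, hr (.inr i) (.inl k) hi, hx⟩
  · exact ⟨i, hr (.inl i) (.inr k) hi, hx⟩
  · exact ⟨i, hr (.inr i) (.inr k) hi, hx⟩

section substitution

variable {I₁ I₂ : Type w}
  {m₁ m₂ : ℕ} {a₁ : I₁ → Fin m₁ → M} {a₂ : I₂ → Fin m₂ → M} {K₁ K₂ R : Type*} [LinearOrder R]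
  {r₁ : K₁ → R} {r₂ : K₂ → R} {c₁ : K₁ → Fin m₁ → M} {c₂ : K₂ → Fin m₂ → M}

/-- The tuples `c₁`, `c₂` on `S` and members of the sequences `a₁`, `a₂` elsewhere. -/
def mix [DecidableEq (K₁ ⊕ K₂)] (a₁ : I₁ → Fin m₁ → M) (a₂ : I₂ → Fin m₂ → M)
    (c₁ : K₁ → Fin m₁ → M) (c₂ : K₂ → Fin m₂ → M) (S : Finset (K₁ ⊕ K₂))
    (τ : ∀ k : K₁ ⊕ K₂, Sum.elim (fun _ => I₁) (fun _ => I₂) k) :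
    (K₁ × Fin m₁) ⊕ (K₂ × Fin m₂) → M :=
  Sum.elim (fun p => if Sum.inl p.1 ∈ S then c₁ p.1 p.2 else a₁ (τ (.inl p.1)) p.2)
    fun p => if Sum.inr p.1 ∈ S then c₂ p.1 p.2 else a₂ (τ (.inr p.1)) p.2

section

variable [DecidableEq (K₁ ⊕ K₂)] {S : Finset (K₁ ⊕ K₂)}
  {τ : ∀ k : K₁ ⊕ K₂, Sum.elim (fun _ => I₁) (fun _ => I₂) k}

theorem mix_inl_of_mem {i : K₁} (h : .inl i ∈ S) (j : Fin m₁) :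
    mix a₁ a₂ c₁ c₂ S τ (.inl (i, j)) = c₁ i j := if_pos h

theorem mix_inr_of_mem {i : K₂} (h : .inr i ∈ S) (j : Fin m₂) :
    mix a₁ a₂ c₁ c₂ S τ (.inr (i, j)) = c₂ i j := if_pos h

theorem mix_inl_of_notMem {i : K₁} (h : .inl i ∉ S) (j : Fin m₁) :
    mix a₁ a₂ c₁ c₂ S τ (.inl (i, j)) = a₁ (τ (.inl i)) j := if_neg h

theorem mix_inr_of_notMem {i : K₂} (h : .inr i ∉ S) (j : Fin m₂) :
    mix a₁ a₂ c₁ c₂ S τ (.inr (i, j)) = a₂ (τ (.inr i)) j := if_neg h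

theorem mix_insert_of_ne {k : K₁ ⊕ K₂} {z : (K₁ × Fin m₁) ⊕ (K₂ × Fin m₂)}
    (hz : Sum.map Prod.fst Prod.fst z ≠ k) (x : Sum.elim (fun _ => I₁) (fun _ => I₂) k) :
    mix a₁ a₂ c₁ c₂ S (Function.update τ k x) z = mix a₁ a₂ c₁ c₂ (insert k S) τ z := by
  rcases z with ⟨i, j⟩ | ⟨i, j⟩
  · by_cases hi : Sum.inl i ∈ S
    · rw [mix_inl_of_mem hi, mix_inl_of_mem (Finset.mem_insert_of_mem hi)]
    · rw [mix_inl_of_notMem hi, mix_inl_of_notMem (by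
        rw [Finset.mem_insert, not_or]; exact ⟨hz, hi⟩)]
      exact congrFun (congrArg a₁ (Function.update_of_ne hz x τ)) j
  · by_cases hi : Sum.inr i ∈ S
    · rw [mix_inr_of_mem hi, mix_inr_of_mem (Finset.mem_insert_of_mem hi)]
    · rw [mix_inr_of_notMem hi, mix_inr_of_notMem (by
        rw [Finset.mem_insert, not_or]; exact ⟨hz, hi⟩)]
      exact congrFun (congrArg a₂ (Function.update_of_ne hz x τ)) j

/-- Every value of `mix` outside the element `k` of largest rank is in the set over which the tuple
of rank `k` realizes an average. -/
theorem mix_insert_mem {A : Set M} (hA₁ : entries a₁ ⊆ A) (hA₂ : entries a₂ ⊆ A)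
    {k : K₁ ⊕ K₂} {x : R} (hS : ∀ j ∈ S, Sum.elim r₁ r₂ j < x)
    {z : (K₁ × Fin m₁) ⊕ (K₂ × Fin m₂)} (hz : Sum.map Prod.fst Prod.fst z ≠ k) :
    mix a₁ a₂ c₁ c₂ (insert k S) τ z ∈
      A ∪ {y | ∃ i, r₁ i < x ∧ y ∈ Set.range (c₁ i)} ∪
        {y | ∃ j, r₂ j < x ∧ y ∈ Set.range (c₂ j)} := by
  rcases z with ⟨i, j⟩ | ⟨i, j⟩
  · by_cases hi : Sum.inl i ∈ S
    · rw [mix_inl_of_mem (Finset.mem_insert_of_mem hi)]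
      exact .inl (.inr ⟨i, hS _ hi, j, rfl⟩)
    · rw [mix_inl_of_notMem (by rw [Finset.mem_insert, not_or]; exact ⟨hz, hi⟩)]
      exact .inl (.inl (hA₁ (Set.mem_iUnion.2 ⟨_, j, rfl⟩)))
  · by_cases hi : Sum.inr i ∈ S
    · rw [mix_inr_of_mem (Finset.mem_insert_of_mem hi)]
      exact .inr ⟨i, hS _ hi, j, rfl⟩
    · rw [mix_inr_of_notMem (by rw [Finset.mem_insert, not_or]; exact ⟨hz, hi⟩)]
      exact .inl (.inl (hA₂ (Set.mem_iUnion.2 ⟨_, j, rfl⟩)))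

end

variable [LinearOrder I₁] [LinearOrder I₂]

/-- The substitution step required by `exists_substitution`: every other entry is of smaller rank or
already a member of `a₁` or `a₂`, hence in the set over which the tuple of rank `k` realizes its
average. This is why `A` must contain both sequences. -/
theorem GenericOver.eventually_mix (hN : NIP L M) [Nonempty I₁] [NoMaxOrder I₁]
    [Nonempty I₂] [NoMaxOrder I₂] [DecidableEq (K₁ ⊕ K₂)]
    (ha₁ : IndiscernibleOver L ∅ a₁) (ha₂ : IndiscernibleOver L ∅ a₂) {A : Set M}
    (hA₁ : entries a₁ ⊆ A) (hA₂ : entries a₂ ⊆ A) (h : GenericOver L A a₁ a₂ r₁ r₂ c₁ c₂)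
    (φ : L.Formula ((K₁ × Fin m₁) ⊕ (K₂ × Fin m₂)))
    (F : ∀ k : K₁ ⊕ K₂, Filter (Sum.elim (fun _ => I₁) (fun _ => I₂) k))
    (hF₁ : ∀ k, F (.inl k) = (Filter.atTop : Filter I₁))
    (hF₂ : ∀ k, F (.inr k) = (Filter.atTop : Filter I₂)) (k : K₁ ⊕ K₂) (S : Finset (K₁ ⊕ K₂))
    (τ : ∀ k : K₁ ⊕ K₂, Sum.elim (fun _ => I₁) (fun _ => I₂) k) (hk : k ∉ S)
    (hS : ∀ j ∈ S, Sum.elim r₁ r₂ j < Sum.elim r₁ r₂ k) :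
    ∀ᶠ x in F k, (φ.Realize (mix a₁ a₂ c₁ c₂ (insert k S) τ) ↔
      φ.Realize (mix a₁ a₂ c₁ c₂ S (Function.update τ k x))) := by
  rcases k with k | k
  · rw [hF₁]
    refine (h.1 k).eventually_iff hN ha₁ φ _
      (fun t : I₁ => mix a₁ a₂ c₁ c₂ S (Function.update τ (.inl k) t)) fun z => ?_
    by_cases hz : Sum.map Prod.fst Prod.fst z = (Sum.inl k : K₁ ⊕ K₂)
    · rcases z with ⟨i, j⟩ | ⟨i, j⟩ <;> cases hz
      refine .inr ⟨j, mix_inl_of_mem (Finset.mem_insert_self _ _) j, fun t => ?_⟩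
      rw [mix_inl_of_notMem hk]
      exact congrFun (congrArg a₁ (Function.update_self (.inl i) t τ)) j
    · exact .inl ⟨mix_insert_mem hA₁ hA₂ hS hz, fun t => mix_insert_of_ne hz _⟩
  · rw [hF₂]
    refine (h.2 k).eventually_iff hN ha₂ φ _
      (fun t : I₂ => mix a₁ a₂ c₁ c₂ S (Function.update τ (.inr k) t)) fun z => ?_
    by_cases hz : Sum.map Prod.fst Prod.fst z = (Sum.inr k : K₁ ⊕ K₂)
    · rcases z with ⟨i, j⟩ | ⟨i, j⟩ <;> cases hz
      refine .inr ⟨j, mix_inr_of_mem (Finset.mem_insert_self _ _) j, fun t => ?_⟩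
      rw [mix_inr_of_notMem hk]
      exact congrFun (congrArg a₂ (Function.update_self (.inr i) t τ)) j
    · exact .inl ⟨mix_insert_mem hA₁ hA₂ hS hz, fun t => mix_insert_of_ne hz _⟩

/-- A formula on two generic families, ranked in the same way, has the same truth value as on
members of the sequences. These may be chosen beginning with the largest rank, each of them large
with respect to those chosen before. -/
theorem GenericOver.exists_realize_iff (hN : NIP L M) [Finite K₁] [Finite K₂]
    [Nonempty I₁] [NoMaxOrder I₁] [Nonempty I₂] [NoMaxOrder I₂]
    (ha₁ : IndiscernibleOver L ∅ a₁) (ha₂ : IndiscernibleOver L ∅ a₂) {A A' : Set M}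
    (hA₁ : entries a₁ ⊆ A) (hA₂ : entries a₂ ⊆ A) (hA₁' : entries a₁ ⊆ A') (hA₂' : entries a₂ ⊆ A')
    (hr : Function.Injective (Sum.elim r₁ r₂))
    (h : GenericOver L A a₁ a₂ r₁ r₂ c₁ c₂) {c₁' : K₁ → Fin m₁ → M} {c₂' : K₂ → Fin m₂ → M}
    (h' : GenericOver L A' a₁ a₂ r₁ r₂ c₁' c₂')
    (φ : L.Formula ((K₁ × Fin m₁) ⊕ (K₂ × Fin m₂))) (T₁ : I₁) (T₂ : I₂)
    (E : I₁ → I₂ → Prop) (E' : I₂ → I₁ → Prop) (hE : ∀ x, ∀ᶠ y in Filter.atTop, E x y)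
    (hE' : ∀ x, ∀ᶠ y in Filter.atTop, E' x y) :
    ∃ (σ : K₁ → I₁) (τ : K₂ → I₂), (∀ k, T₁ < σ k) ∧ (∀ k, T₂ < τ k) ∧
      (∀ i j, r₁ i < r₁ j → σ j < σ i) ∧ (∀ i j, r₂ i < r₂ j → τ j < τ i) ∧
      (∀ i j, r₂ j < r₁ i → E (σ i) (τ j)) ∧ (∀ i j, r₁ i < r₂ j → E' (τ j) (σ i)) ∧
      (φ.Realize (pairVal c₁ c₂) ↔ φ.Realize (pairVal (a₁ ∘ σ) (a₂ ∘ τ))) ∧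
      (φ.Realize (pairVal c₁' c₂') ↔ φ.Realize (pairVal (a₁ ∘ σ) (a₂ ∘ τ))) := by
  classical
  have := Fintype.ofFinite K₁
  have := Fintype.ofFinite K₂
  let X : K₁ ⊕ K₂ → Type _ := Sum.elim (fun _ => I₁) (fun _ => I₂)
  let F : ∀ k, Filter (X k) := fun k => match k with
    | .inl _ => (Filter.atTop : Filter I₁)
    | .inr _ => (Filter.atTop : Filter I₂)
  have hF : ∀ k, (F k).NeBot := by
    rintro (k | k)
    · exact (inferInstance : (Filter.atTop : Filter I₁).NeBot)
    · exact (inferInstance : (Filter.atTop : Filter I₂).NeBot)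
  let G : ∀ k, X k → Prop := fun k => match k with
    | .inl _ => fun x : I₁ => T₁ < x
    | .inr _ => fun x : I₂ => T₂ < x
  let D : ∀ j k, X j → X k → Prop := fun j k => match j, k with
    | .inl _, .inl _ => fun x y : I₁ => x < y
    | .inr _, .inr _ => fun x y : I₂ => x < y
    | .inl _, .inr _ => fun (x : I₁) (y : I₂) => E x y
    | .inr _, .inl _ => fun (x : I₂) (y : I₁) => E' x y
  have hG : ∀ k, ∀ᶠ x in F k, G k x := by
    rintro (k | k)
    · exact Filter.eventually_gt_atTop T₁
    · exact Filter.eventually_gt_atTop T₂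
  have hD : ∀ j k x, ∀ᶠ y in F k, D j k x y := by
    rintro (j | j) (k | k) x
    · exact Filter.eventually_gt_atTop (α := I₁) x
    · exact hE x
    · exact hE' x
    · exact Filter.eventually_gt_atTop (α := I₂) x
  obtain ⟨τ, -, h2, h3, h4, h5⟩ := exists_substitution hr F G D hG hD
    (fun S τ => φ.Realize (mix a₁ a₂ c₁ c₂ S τ)) (fun S τ => φ.Realize (mix a₁ a₂ c₁' c₂' S τ))
    (h.eventually_mix hN ha₁ ha₂ hA₁ hA₂ φ F (fun _ => rfl) fun _ => rfl)
    (h'.eventually_mix hN ha₁ ha₂ hA₁' hA₂' φ F (fun _ => rfl) fun _ => rfl)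
    Finset.univ fun k => match k with
      | .inl _ => (Classical.arbitrary I₁ : I₁)
      | .inr _ => (Classical.arbitrary I₂ : I₂)
  refine ⟨fun k => τ (.inl k), fun k => τ (.inr k), fun k => h2 (.inl k) (Finset.mem_univ _),
    fun k => h2 (.inr k) (Finset.mem_univ _),
    fun i j hij => h3 (.inl i) (Finset.mem_univ _) (.inl j) hij,
    fun i j hij => h3 (.inr i) (Finset.mem_univ _) (.inr j) hij,
    fun i j hij => h3 (.inr j) (Finset.mem_univ _) (.inl i) hij,
    fun i j hij => h3 (.inl i) (Finset.mem_univ _) (.inr j) hij, ?_, ?_⟩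
  · simp only [mix, Finset.mem_univ, if_true, Finset.notMem_empty, if_false] at h4
    exact h4
  · simp only [mix, Finset.mem_univ, if_true, Finset.notMem_empty, if_false] at h5
    exact h5

end substitution

/-! ### Mutual indiscernibility in terms of formulas without parameters -/

section

variable {I₁ I₂ : Type*} [LinearOrder I₁] [LinearOrder I₂] {m₁ m₂ : ℕ}
  {a₁ : I₁ → Fin m₁ → M} {a₂ : I₂ → Fin m₂ → M}

/-- A formula mentions finitely many parameters from `entries a₂`, and these occur in finitely many
members of `a₂`, which can be listed in increasing order. -/
theorem indiscernibleOver_entries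
    (h : ∀ (n l : ℕ) (φ : L.Formula ((Fin n × Fin m₁) ⊕ (Fin l × Fin m₂))) (s s' : Fin n → I₁)
      (t : Fin l → I₂), StrictMono s → StrictMono s' → StrictMono t →
      (φ.Realize (pairVal (a₁ ∘ s) (a₂ ∘ t)) ↔ φ.Realize (pairVal (a₁ ∘ s') (a₂ ∘ t)))) :
    IndiscernibleOver L (entries a₂) a₁ := by
  classical
  intro n φ s s' hs hs'
  obtain ⟨S, ψ, hψ⟩ := exists_restrict (M := M) φ
  have hmem : ∀ x : entries a₂, ∃ t j, a₂ t j = x := fun x => by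
    obtain ⟨t, j, h⟩ := Set.mem_iUnion.1 x.2
    exact ⟨t, j, h⟩
  choose t j htj using hmem
  let V : Finset I₂ := S.toLeft.image t
  let e := V.orderIsoOfFin rfl
  have hV : ∀ x, Sum.inl x ∈ S → t x ∈ V := fun x hx =>
    Finset.mem_image_of_mem _ (Finset.mem_toLeft.2 hx)
  let g : S → (Fin n × Fin m₁) ⊕ (Fin V.card × Fin m₂) := fun z => match z with
    | ⟨.inl x, hx⟩ => .inr (e.symm ⟨t x, hV x hx⟩, j x)
    | ⟨.inr p, _⟩ => .inl p
  have key : ∀ s : Fin n → I₁, φ.Realize (Sum.elim (fun x : entries a₂ => (x : M))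
      fun p => a₁ (s p.1) p.2) ↔
      (ψ.relabel g).Realize (pairVal (a₁ ∘ s) (a₂ ∘ fun i => (e i : I₂))) := by
    intro s
    rw [hψ, Formula.realize_relabel]
    apply iff_of_eq
    congr 1
    ext z
    rcases z with ⟨z | z, hz⟩
    · simp [g, pairVal, htj]
    · simp [g, pairVal]
  rw [key, key]
  exact h _ _ _ _ _ _ hs hs' fun i i' hi => e.strictMono hi

theorem realize_pairVal_swap {K₁ K₂ : Type*} (φ : L.Formula ((K₁ × Fin m₁) ⊕ (K₂ × Fin m₂)))
    (x : K₁ → Fin m₁ → M) (y : K₂ → Fin m₂ → M) :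
    (φ.relabel Sum.swap).Realize (pairVal y x) ↔ φ.Realize (pairVal x y) := by
  rw [Formula.realize_relabel]
  apply iff_of_eq
  congr 1
  ext z
  rcases z with z | z <;> rfl

theorem realize_pairVal_relabel {K₁ K₂ K₁' K₂' : Type*}
    (φ : L.Formula ((K₁ × Fin m₁) ⊕ (K₂ × Fin m₂))) (f : K₁ → K₁') (g : K₂ → K₂')
    (x : K₁' → Fin m₁ → M) (y : K₂' → Fin m₂ → M) :
    (φ.relabel (Sum.map (Prod.map f id) (Prod.map g id))).Realize (pairVal x y) ↔
      φ.Realize (pairVal (x ∘ f) (y ∘ g)) := by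
  rw [Formula.realize_relabel]
  apply iff_of_eq
  congr 1
  ext z
  rcases z with z | z <;> rfl

/-- One tuple is moved at a time, the other serving as parameters. The parameter-free form is the
one to which substitution applies. -/
theorem mutuallyIndiscernible_iff :
    MutuallyIndiscernible L a₁ a₂ ↔
      ∀ (n l : ℕ) (φ : L.Formula ((Fin n × Fin m₁) ⊕ (Fin l × Fin m₂))) (s s' : Fin n → I₁)
        (t t' : Fin l → I₂), StrictMono s → StrictMono s' → StrictMono t → StrictMono t' →
        (φ.Realize (pairVal (a₁ ∘ s) (a₂ ∘ t)) ↔ φ.Realize (pairVal (a₁ ∘ s') (a₂ ∘ t'))) := by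
  refine ⟨fun h n l φ s s' t t' hs hs' ht ht' => ?_, fun h => ⟨?_, ?_⟩⟩
  · have h1 := h.1.realize_iff (φ.relabel Sum.swap) (fun p : Fin l × Fin m₂ => a₂ (t p.1) p.2)
      (fun p => Set.mem_iUnion.2 ⟨_, _, rfl⟩) hs hs'
    have h2 := h.2.realize_iff φ (fun p : Fin n × Fin m₁ => a₁ (s' p.1) p.2)
      (fun p => Set.mem_iUnion.2 ⟨_, _, rfl⟩) ht ht'
    exact ((realize_pairVal_swap φ (a₁ ∘ s) (a₂ ∘ t)).symm.trans h1).trans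
      ((realize_pairVal_swap φ (a₁ ∘ s') (a₂ ∘ t)).trans h2)
  · exact indiscernibleOver_entries fun n l φ s s' t hs hs' ht => h n l φ s s' t t hs hs' ht ht
  · refine indiscernibleOver_entries fun n l φ s s' t hs hs' ht => ?_
    rw [← realize_pairVal_swap φ (a₂ ∘ s), ← realize_pairVal_swap φ (a₂ ∘ s')]
    exact h _ _ _ t t s s' ht ht hs hs'

theorem strictMono_comp_rev {n : ℕ} {I : Type*} [LinearOrder I] {s : Fin n → I}
    (hs : StrictAnti s) : StrictMono (s ∘ Fin.rev) := fun _ _ h => hs (Fin.rev_lt_rev.2 h)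

theorem realize_pairVal_rev {n l : ℕ} (φ : L.Formula ((Fin n × Fin m₁) ⊕ (Fin l × Fin m₂)))
    (x : Fin n → Fin m₁ → M) (y : Fin l → Fin m₂ → M) :
    (φ.relabel (Sum.map (Prod.map Fin.rev id) (Prod.map Fin.rev id))).Realize
      (pairVal (x ∘ Fin.rev) (y ∘ Fin.rev)) ↔ φ.Realize (pairVal x y) := by
  rw [realize_pairVal_relabel]
  simp [Function.comp_assoc, Fin.rev_involutive.comp_self]

/-- Substitution yields decreasing tuples; reversing the order of the variables makes them
increasing. -/
theorem MutuallyIndiscernible.realize_iff_of_strictAnti (h : MutuallyIndiscernible L a₁ a₂)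
    {n l : ℕ} (φ : L.Formula ((Fin n × Fin m₁) ⊕ (Fin l × Fin m₂))) {s s' : Fin n → I₁}
    {t t' : Fin l → I₂} (hs : StrictAnti s) (hs' : StrictAnti s') (ht : StrictAnti t)
    (ht' : StrictAnti t') :
    φ.Realize (pairVal (a₁ ∘ s) (a₂ ∘ t)) ↔ φ.Realize (pairVal (a₁ ∘ s') (a₂ ∘ t')) := by
  rw [← realize_pairVal_rev φ, ← realize_pairVal_rev φ (a₁ ∘ s')]
  exact mutuallyIndiscernible_iff.1 h _ _ _ _ _ _ _ (strictMono_comp_rev hs)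
    (strictMono_comp_rev hs') (strictMono_comp_rev ht) (strictMono_comp_rev ht')

end

/-! ### Sequences built from averages -/

/-- The lexicographic rank, with `false` for the first sequence and `true` for the second, records
the order of construction: at equal index `b₁` comes before `b₂`. -/
theorem BuiltFromAverages.genericOver {I₁ I₂ N : Type*} [LinearOrder I₁] [LinearOrder I₂]
    [LinearOrder N] {m₁ m₂ : ℕ} {a₁ : I₁ → Fin m₁ → M} {a₂ : I₂ → Fin m₂ → M}
    {b₁ : N → Fin m₁ → M} {b₂ : N → Fin m₂ → M} (h : BuiltFromAverages L a₁ a₂ b₁ b₂)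
    {K₁ K₂ : Type*} (s : K₁ → N) (t : K₂ → N) :
    GenericOver L (entries a₁ ∪ entries a₂) a₁ a₂ (fun k => toLex (s k, false))
      (fun k => toLex (t k, true)) (b₁ ∘ s) (b₂ ∘ t) := by
  refine ⟨fun k => (h (s k)).1.mono ?_, fun k => (h (t k)).2.mono ?_⟩
  · rintro x ((hx | ⟨i, hi, hx⟩) | ⟨i, hi, hx⟩)
    · exact .inl hx
    · have : s i < s k := by simpa [Prod.Lex.toLex_lt_toLex] using hi
      exact .inr (Set.mem_iUnion.2 ⟨⟨s i, this⟩, .inl hx⟩)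
    · have : t i < s k := by
        simpa [Prod.Lex.toLex_lt_toLex, (by decide : ¬ (true < false))] using hi
      exact .inr (Set.mem_iUnion.2 ⟨⟨t i, this⟩, .inr hx⟩)
  · rintro x ((hx | ⟨i, hi, hx⟩) | ⟨i, hi, hx⟩)
    · exact .inl (.inl hx)
    · have : s i < t k ∨ s i = t k := by simpa [Prod.Lex.toLex_lt_toLex] using hi
      rcases this with h | h
      · exact .inl (.inr (Set.mem_iUnion.2 ⟨⟨s i, h⟩, .inl hx⟩))
      · exact .inr (h ▸ hx)
    · have : t i < t k := by simpa [Prod.Lex.toLex_lt_toLex] using hi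
      exact .inl (.inr (Set.mem_iUnion.2 ⟨⟨t i, this⟩, .inr hx⟩))

theorem rank_injective {N K₁ K₂ : Type*} {s : K₁ → N} {t : K₂ → N}
    (hs : Function.Injective s) (ht : Function.Injective t) :
    Function.Injective (Sum.elim (fun k => toLex (s k, false)) fun k => toLex (t k, true)) := by
  rintro (x | x) (y | y) h
  · exact congrArg _ (hs (congrArg (fun z => (ofLex z).1) h))
  · exact absurd (congrArg (fun z => (ofLex z).2) h) (by simp)
  · exact absurd (congrArg (fun z => (ofLex z).2) h) (by simp)
  · exact congrArg _ (ht (congrArg (fun z => (ofLex z).1) h))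

section

variable {I₁ I₂ : Type w} [LinearOrder I₁] [LinearOrder I₂] [Nonempty I₁] [NoMaxOrder I₁]
  [Nonempty I₂] [NoMaxOrder I₂] {m₁ m₂ : ℕ} {a₁ : I₁ → Fin m₁ → M} {a₂ : I₂ → Fin m₂ → M}

/-- The truth value of a formula on tuples from sequences built from averages depends only on the
relative order of the indices. -/
theorem BuiltFromAverages.realize_iff (hN : NIP L M)
    (ha₁ : IndiscernibleOver L ∅ a₁) (ha₂ : IndiscernibleOver L ∅ a₂)
    {N N' : Type*} [LinearOrder N] [LinearOrder N']
    {b₁ : N → Fin m₁ → M} {b₂ : N → Fin m₂ → M} (h : BuiltFromAverages L a₁ a₂ b₁ b₂)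
    {b₁' : N' → Fin m₁ → M} {b₂' : N' → Fin m₂ → M} (h' : BuiltFromAverages L a₁ a₂ b₁' b₂')
    {n l : ℕ} (φ : L.Formula ((Fin n × Fin m₁) ⊕ (Fin l × Fin m₂)))
    {s : Fin n → N} {t : Fin l → N} {s' : Fin n → N'} {t' : Fin l → N'} (hs : StrictMono s)
    (ht : StrictMono t) (hs' : StrictMono s') (ht' : StrictMono t')
    (hst : ∀ i j, s i ≤ t j ↔ s' i ≤ t' j) :
    φ.Realize (pairVal (b₁ ∘ s) (b₂ ∘ t)) ↔ φ.Realize (pairVal (b₁' ∘ s') (b₂' ∘ t')) := by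
  have g := h.genericOver s t
  -- The second pair is ranked by the indices of the first, which `hst` permits.
  have g' := (h'.genericOver s' t').congr_rank (r₁' := fun k => toLex (s k, false))
    (r₂' := fun k => toLex (t k, true)) (by
      have hts : ∀ i j, t j < s i ↔ t' j < s' i := fun i j => by
        simpa only [not_le] using not_congr (hst i j)
      rintro (x | x) (y | y) hxy
      · simpa [Prod.Lex.toLex_lt_toLex, hs.lt_iff_lt, hs'.lt_iff_lt] using hxy
      · simpa [Prod.Lex.toLex_lt_toLex, ← le_iff_lt_or_eq, hst] using hxy
      · simpa [Prod.Lex.toLex_lt_toLex, hts, (by decide : ¬ (true < false))] using hxy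
      · simpa [Prod.Lex.toLex_lt_toLex, ht.lt_iff_lt, ht'.lt_iff_lt] using hxy)
  obtain ⟨σ, τ, -, -, -, -, -, -, h1, h2⟩ := g.exists_realize_iff hN ha₁ ha₂ Set.subset_union_left
    Set.subset_union_right Set.subset_union_left Set.subset_union_right
    (rank_injective hs.injective ht.injective) g' φ (Classical.arbitrary I₁)
    (Classical.arbitrary I₂)
    (fun _ _ => True) (fun _ _ => True) (by simp) (by simp)
  exact h1.trans h2.symm

/-- Tuples from sequences built from averages satisfy the same formula as suitable decreasing tuples
from end segments of the original sequences. -/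
theorem BuiltFromAverages.exists_realize_iff (hN : NIP L M)
    (ha₁ : IndiscernibleOver L ∅ a₁) (ha₂ : IndiscernibleOver L ∅ a₂) {N : Type*} [LinearOrder N]
    {b₁ : N → Fin m₁ → M} {b₂ : N → Fin m₂ → M} (h : BuiltFromAverages L a₁ a₂ b₁ b₂)
    {n l : ℕ} (φ : L.Formula ((Fin n × Fin m₁) ⊕ (Fin l × Fin m₂)))
    {s : Fin n → N} {t : Fin l → N} (hs : StrictMono s) (ht : StrictMono t) (T₁ : I₁) (T₂ : I₂) :
    ∃ (σ : Fin n → I₁) (τ : Fin l → I₂), StrictAnti σ ∧ StrictAnti τ ∧ (∀ i, T₁ < σ i) ∧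
      (∀ i, T₂ < τ i) ∧
      (φ.Realize (pairVal (b₁ ∘ s) (b₂ ∘ t)) ↔ φ.Realize (pairVal (a₁ ∘ σ) (a₂ ∘ τ))) := by
  have g := h.genericOver s t
  obtain ⟨σ, τ, h1, h2, h3, h4, -, -, h5, -⟩ := g.exists_realize_iff hN ha₁ ha₂
    Set.subset_union_left Set.subset_union_right Set.subset_union_left Set.subset_union_right
    (rank_injective hs.injective ht.injective) g φ T₁ T₂
    (fun _ _ => True) (fun _ _ => True) (by simp) (by simp)
  refine ⟨σ, τ, fun i j hij => h3 i j ?_, fun i j hij => h4 i j ?_, h1, h2, h5⟩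
  · simpa [Prod.Lex.toLex_lt_toLex] using hs hij
  · simpa [Prod.Lex.toLex_lt_toLex] using ht hij

/-- Any two increasing pairs from `b₁`, `b₂` are replaced by decreasing pairs from `a₁`, `a₂`, on
which the formula cannot differ. -/
theorem MutuallyIndiscernible.of_builtFromAverages (hN : NIP L M)
    (ha₁ : IndiscernibleOver L ∅ a₁) (ha₂ : IndiscernibleOver L ∅ a₂)
    (ha : MutuallyIndiscernible L a₁ a₂) {N : Type*} [LinearOrder N]
    {b₁ : N → Fin m₁ → M} {b₂ : N → Fin m₂ → M} (h : BuiltFromAverages L a₁ a₂ b₁ b₂) :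
    MutuallyIndiscernible L b₁ b₂ := by
  refine mutuallyIndiscernible_iff.2 fun n l φ s s' t t' hs hs' ht ht' => ?_
  obtain ⟨σ, τ, hσ, hτ, -, -, e⟩ := h.exists_realize_iff hN ha₁ ha₂ φ hs ht
    (Classical.arbitrary I₁) (Classical.arbitrary I₂)
  obtain ⟨σ', τ', hσ', hτ', -, -, e'⟩ := h.exists_realize_iff hN ha₁ ha₂ φ hs' ht'
    (Classical.arbitrary I₁) (Classical.arbitrary I₂)
  rw [e, e']
  exact ha.realize_iff_of_strictAnti φ hσ hσ' hτ hτ'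

/-- Two pairs of sequences built from the same averages have the same type. -/
theorem BuiltFromAverages.mutuallyIndiscernible (hN : NIP L M)
    (ha₁ : IndiscernibleOver L ∅ a₁) (ha₂ : IndiscernibleOver L ∅ a₂) {N : Type*} [LinearOrder N]
    {b₁ : N → Fin m₁ → M} {b₂ : N → Fin m₂ → M} (h : BuiltFromAverages L a₁ a₂ b₁ b₂)
    {c₁ : N → Fin m₁ → M} {c₂ : N → Fin m₂ → M} (hc : BuiltFromAverages L a₁ a₂ c₁ c₂)
    (hmi : MutuallyIndiscernible L c₁ c₂) : MutuallyIndiscernible L b₁ b₂ := by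
  refine mutuallyIndiscernible_iff.2 fun n l φ s s' t t' hs hs' ht ht' => ?_
  rw [h.realize_iff hN ha₁ ha₂ hc φ hs ht hs ht fun _ _ => Iff.rfl,
    h.realize_iff hN ha₁ ha₂ hc φ hs' ht' hs' ht' fun _ _ => Iff.rfl]
  exact mutuallyIndiscernible_iff.1 hmi n l φ s s' t t' hs hs' ht ht'

theorem BuiltFromAverages.indiscernible_left (hN : NIP L M)
    (ha₁ : IndiscernibleOver L ∅ a₁) (ha₂ : IndiscernibleOver L ∅ a₂) {N : Type*} [LinearOrder N]
    {b₁ : N → Fin m₁ → M} {b₂ : N → Fin m₂ → M} (h : BuiltFromAverages L a₁ a₂ b₁ b₂) :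
    IndiscernibleOver L ∅ b₁ := by
  intro n φ s s' hs hs'
  let ψ : L.Formula (Fin n × Fin m₁) := φ.relabel (Sum.elim (fun x => x.2.elim) id)
  -- No tuple is taken from the second sequence, so the results on pairs apply.
  let χ : L.Formula ((Fin n × Fin m₁) ⊕ (Fin 0 × Fin m₂)) := ψ.relabel .inl
  have key : ∀ {I : Type _} (x : I → Fin m₁ → M) (s : Fin n → I) (y : Fin 0 → Fin m₂ → M),
      χ.Realize (pairVal (x ∘ s) y) ↔ ψ.Realize fun p => x (s p.1) p.2 := fun x s y => by
    rw [Formula.realize_relabel]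
    rfl
  have key' : ∀ s : Fin n → N, φ.Realize (Sum.elim (fun x : (∅ : Set M) => (x : M))
      fun p => b₁ (s p.1) p.2) ↔ χ.Realize (pairVal (b₁ ∘ s) (b₂ ∘ Fin.elim0)) := fun s => by
    rw [Formula.realize_relabel, Formula.realize_relabel]
    apply iff_of_eq
    congr 1
    ext z
    rcases z with z | z
    · exact z.2.elim
    · rfl
  have h0 : StrictMono (Fin.elim0 : Fin 0 → N) := fun i => i.elim0
  obtain ⟨σ, τ, hσ, -, -, -, e⟩ := h.exists_realize_iff hN ha₁ ha₂ χ hs h0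
    (Classical.arbitrary I₁) (Classical.arbitrary I₂)
  obtain ⟨σ', τ', hσ', -, -, -, e'⟩ := h.exists_realize_iff hN ha₁ ha₂ χ hs' h0
    (Classical.arbitrary I₁) (Classical.arbitrary I₂)
  rw [key', key', e, e', key, key]
  -- A decreasing tuple is an increasing one indexed by the order dual.
  exact ha₁.realize_iff_of_empty (K := (Fin n)ᵒᵈ) ψ (fun _ _ h => hσ h) (fun _ _ h => hσ' h)

theorem BuiltFromAverages.indiscernible_right (hN : NIP L M)
    (ha₁ : IndiscernibleOver L ∅ a₁) (ha₂ : IndiscernibleOver L ∅ a₂) {N : Type*} [LinearOrder N]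
    {b₁ : N → Fin m₁ → M} {b₂ : N → Fin m₂ → M} (h : BuiltFromAverages L a₁ a₂ b₁ b₂) :
    IndiscernibleOver L ∅ b₂ := by
  intro n φ s s' hs hs'
  let ψ : L.Formula (Fin n × Fin m₂) := φ.relabel (Sum.elim (fun x => x.2.elim) id)
  let χ : L.Formula ((Fin 0 × Fin m₁) ⊕ (Fin n × Fin m₂)) := ψ.relabel .inr
  have key : ∀ {I : Type _} (x : I → Fin m₂ → M) (s : Fin n → I) (y : Fin 0 → Fin m₁ → M),
      χ.Realize (pairVal y (x ∘ s)) ↔ ψ.Realize fun p => x (s p.1) p.2 := fun x s y => by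
    rw [Formula.realize_relabel]
    rfl
  have key' : ∀ s : Fin n → N, φ.Realize (Sum.elim (fun x : (∅ : Set M) => (x : M))
      fun p => b₂ (s p.1) p.2) ↔ χ.Realize (pairVal (b₁ ∘ Fin.elim0) (b₂ ∘ s)) := fun s => by
    rw [Formula.realize_relabel, Formula.realize_relabel]
    apply iff_of_eq
    congr 1
    ext z
    rcases z with z | z
    · exact z.2.elim
    · rfl
  have h0 : StrictMono (Fin.elim0 : Fin 0 → N) := fun i => i.elim0
  obtain ⟨σ, τ, -, hτ, -, -, e⟩ := h.exists_realize_iff hN ha₁ ha₂ χ h0 hs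
    (Classical.arbitrary I₁) (Classical.arbitrary I₂)
  obtain ⟨σ', τ', -, hτ', -, -, e'⟩ := h.exists_realize_iff hN ha₁ ha₂ χ h0 hs'
    (Classical.arbitrary I₁) (Classical.arbitrary I₂)
  rw [key', key', e, e', key, key]
  exact ha₂.realize_iff_of_empty (K := (Fin n)ᵒᵈ) ψ (fun _ _ h => hτ h) (fun _ _ h => hτ' h)

end

/-! ### Existence of sequences built from averages -/

/-- Finitely many formulas of an average hold together at a single member of large index, so
saturation applies. -/
theorem exists_realizesAv {κ : Cardinal.{w}} (hM : IsSaturated L M κ) {A : Set M} (hA : #A < κ)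
    {I : Type*} [LinearOrder I] [Nonempty I] {m : ℕ} (a : I → Fin m → M) :
    ∃ b, RealizesAv L A a b := by
  refine hM A hA m (Av L A a) fun q hq => ?_
  obtain ⟨t, ht⟩ := ((Filter.eventually_all_finset q).2 fun φ hφ => hq hφ).exists
  exact ⟨a t, ht⟩

theorem exists_seq_of_forall_exists {Y : Type*} [Nonempty Y] (P : ℕ → (ℕ → Y) → Y → Prop)
    (hP : ∀ n f g y, (∀ k < n, f k = g k) → P n f y → P n g y) (h : ∀ n f, ∃ y, P n f y) :
    ∃ f : ℕ → Y, ∀ n, P n f (f n) := by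
  classical
  choose c hc using h
  let F : ∀ n, (∀ k, k < n → Y) → Y := fun n ih =>
    -- The default values from `n` on are harmless, since by `hP` the condition at `n` depends only
    -- on earlier values.
    c n fun k => if h : k < n then ih k h else Classical.arbitrary Y
  let f : ℕ → Y := wellFounded_lt.fix F
  refine ⟨f, fun n => ?_⟩
  have hf : f n = c n fun k => if k < n then f k else Classical.arbitrary Y :=
    WellFounded.fix_eq _ _ _
  rw [hf]
  exact hP n _ f _ (fun k hk => if_pos hk) (hc n _)

theorem mk_entries_lt {κ : Cardinal.{w}} (hκ : ℵ₀ < κ) {I : Type w} (hI : #I < κ) {m : ℕ}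
    (a : I → Fin m → M) : #(entries a) < κ := by
  have h : entries a = Set.range fun p : I × ULift.{w} (Fin m) => a p.1 p.2.down := by
    ext x
    simp [entries]
  rw [h]
  refine mk_range_le.trans_lt ?_
  rw [mk_prod, lift_id, lift_id]
  exact mul_lt_of_lt hκ.le hI ((lt_aleph0_of_finite _).trans hκ)

theorem base_subset {I₁ I₂ N : Type*} [LT N] {m₁ m₂ : ℕ} (a₁ : I₁ → Fin m₁ → M)
    (a₂ : I₂ → Fin m₂ → M) {b₁ c₁ : N → Fin m₁ → M} {b₂ c₂ : N → Fin m₂ → M} {α : N}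
    (h₁ : ∀ β < α, b₁ β = c₁ β) (h₂ : ∀ β < α, b₂ β = c₂ β) :
    base a₁ a₂ b₁ b₂ α ⊆ base a₁ a₂ c₁ c₂ α :=
  Set.union_subset_union_right _ (Set.iUnion_mono fun β => by rw [h₁ β β.2, h₂ β β.2])

/-- The additional set `A` allows one pair to be built over further sequences, as needed when
comparing equivalent ones. -/
theorem exists_built {κ : Cardinal.{w}} (hM : IsSaturated L M κ) [Nonempty M] (hκ : ℵ₀ < κ)
    {A : Set M} (hA : #A < κ) {I₁ I₂ : Type w} [LinearOrder I₁] [LinearOrder I₂] [Nonempty I₁]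
    [Nonempty I₂] (hI₁ : #I₁ < κ) (hI₂ : #I₂ < κ) {m₁ m₂ : ℕ} (a₁ : I₁ → Fin m₁ → M)
    (a₂ : I₂ → Fin m₂ → M) :
    ∃ (b₁ : ℕ → Fin m₁ → M) (b₂ : ℕ → Fin m₂ → M), ∀ n,
      RealizesAv L (A ∪ base a₁ a₂ b₁ b₂ n) a₁ (b₁ n) ∧
        RealizesAv L (A ∪ (base a₁ a₂ b₁ b₂ n ∪ Set.range (b₁ n))) a₂ (b₂ n) := by
  have hfin : ∀ s : Set M, s.Finite → #s < κ := fun s hs => hs.lt_aleph0.trans hκ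
  have hun : ∀ s t : Set M, #s < κ → #t < κ → #(s ∪ t : Set M) < κ := fun s t hs ht =>
    (mk_union_le s t).trans_lt (add_lt_of_lt hκ.le hs ht)
  let P : ℕ → (ℕ → (Fin m₁ → M) × (Fin m₂ → M)) → (Fin m₁ → M) × (Fin m₂ → M) → Prop :=
    fun n f y =>
      RealizesAv L (A ∪ base a₁ a₂ (fun k => (f k).1) (fun k => (f k).2) n) a₁ y.1 ∧
        RealizesAv L (A ∪ (base a₁ a₂ (fun k => (f k).1) (fun k => (f k).2) n ∪ Set.range y.1))
          a₂ y.2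
  have hP : ∀ n f g y, (∀ k < n, f k = g k) → P n f y → P n g y := by
    rintro n f g y hfg ⟨h1, h2⟩
    have := base_subset a₁ a₂ (fun k hk => congrArg Prod.fst (hfg k hk).symm)
      fun k hk => congrArg Prod.snd (hfg k hk).symm
    exact ⟨h1.mono (Set.union_subset_union_right _ this),
      h2.mono (Set.union_subset_union_right _ (Set.union_subset_union_left _ this))⟩
  have hex : ∀ n f, ∃ y, P n f y := by
    intro n f
    have hb : #(base a₁ a₂ (fun k => (f k).1) (fun k => (f k).2) n) < κ := by
      refine hun _ _ (hun _ _ (mk_entries_lt hκ hI₁ a₁) (mk_entries_lt hκ hI₂ a₂)) (hfin _ ?_)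
      have : Finite {β // β < n} := (Set.finite_lt_nat n).to_subtype
      exact Set.finite_iUnion fun β => (Set.finite_range _).union (Set.finite_range _)
    obtain ⟨y₁, h₁⟩ := exists_realizesAv hM (hun _ _ hA hb) a₁
    obtain ⟨y₂, h₂⟩ := exists_realizesAv hM
      (hun _ _ hA (hun _ _ hb (hfin _ (Set.finite_range y₁)))) a₂
    exact ⟨(y₁, y₂), h₁, h₂⟩
  obtain ⟨f, hf⟩ := exists_seq_of_forall_exists P hP hex
  exact ⟨fun k => (f k).1, fun k => (f k).2, hf⟩

theorem IsMonster.aleph0_lt {T : L.Theory} {κ : Cardinal.{w}} (hM : IsMonster L T M κ) :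
    ℵ₀ < κ := by
  have h := (lift_le.2 (le_max_left ℵ₀ L.card)).trans_lt hM.card_lt
  rwa [lift_aleph0, ← lift_aleph0.{max u v, w}, lift_lt] at h

/-! ### Perpendicularity: testing on one pair, and symmetry -/

section perpendicular

variable {T : L.Theory} {κ : Cardinal.{w}} {I₁ I₂ : Type w} [LinearOrder I₁] [LinearOrder I₂]
  {m₁ m₂ : ℕ} {a₁ : I₁ → Fin m₁ → M} {a₂ : I₂ → Fin m₂ → M}

theorem exists_builtFromAverages (hM : IsMonster L T M κ) (h₁ : IsEndlessIndiscernible L κ a₁)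
    (h₂ : IsEndlessIndiscernible L κ a₂) :
    ∃ (b₁ : ℕ → Fin m₁ → M) (b₂ : ℕ → Fin m₂ → M), BuiltFromAverages L a₁ a₂ b₁ b₂ := by
  have := hM.nonempty
  have := h₁.1
  have := h₂.1
  obtain ⟨b₁, b₂, h⟩ := exists_built hM.saturated hM.aleph0_lt (A := ∅)
    (by simpa using aleph0_pos.trans hM.aleph0_lt) h₁.2.2.1 h₂.2.2.1 a₁ a₂
  exact ⟨b₁, b₂, fun n => ⟨(h n).1.mono Set.subset_union_right,
    (h n).2.mono Set.subset_union_right⟩⟩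

theorem perpendicular_of_built (hN : NIP L M) (h₁ : IsEndlessIndiscernible L κ a₁)
    (h₂ : IsEndlessIndiscernible L κ a₂) {c₁ : ℕ → Fin m₁ → M} {c₂ : ℕ → Fin m₂ → M}
    (hc : BuiltFromAverages L a₁ a₂ c₁ c₂) (hmi : MutuallyIndiscernible L c₁ c₂) :
    Perpendicular L a₁ a₂ := by
  obtain ⟨_, _, _, h₁⟩ := h₁
  obtain ⟨_, _, _, h₂⟩ := h₂
  exact fun b₁ b₂ hb => hb.mutuallyIndiscernible hN h₁ h₂ hc hmi

theorem MutuallyIndiscernible.perpendicular (hN : NIP L M) (h₁ : IsEndlessIndiscernible L κ a₁)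
    (h₂ : IsEndlessIndiscernible L κ a₂) (h : MutuallyIndiscernible L a₁ a₂) :
    Perpendicular L a₁ a₂ := by
  obtain ⟨_, _, _, h₁⟩ := h₁
  obtain ⟨_, _, _, h₂⟩ := h₂
  exact fun b₁ b₂ hb => h.of_builtFromAverages hN h₁ h₂ hb

/-- Without its first tuple, the order of construction reads `c₂ 0, c₁ 1, c₂ 1, c₁ 2, …`, which
begins with the second sequence. -/
theorem BuiltFromAverages.swap {c₁ : ℕ → Fin m₁ → M} {c₂ : ℕ → Fin m₂ → M}
    (hc : BuiltFromAverages L a₁ a₂ c₁ c₂) :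
    BuiltFromAverages L a₂ a₁ c₂ fun n => c₁ (n + 1) := by
  refine fun n => ⟨(hc n).2.mono ?_, (hc (n + 1)).1.mono ?_⟩
  · rintro x ((hx | hx) | hx)
    · exact .inl (.inl (.inr hx))
    · exact .inl (.inl (.inl hx))
    · obtain ⟨⟨k, hk⟩, hx | hx⟩ := Set.mem_iUnion.1 hx
      · exact .inl (.inr (Set.mem_iUnion.2 ⟨⟨k, hk⟩, .inr hx⟩))
      · rcases (Nat.succ_le_of_lt hk).lt_or_eq with hk' | rfl
        · exact .inl (.inr (Set.mem_iUnion.2 ⟨⟨k + 1, hk'⟩, .inl hx⟩))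
        · exact .inr hx
  · rintro x (((hx | hx) | hx) | hx)
    · exact .inl (.inr hx)
    · exact .inl (.inl hx)
    · obtain ⟨⟨k, hk⟩, hx | hx⟩ := Set.mem_iUnion.1 hx
      · exact .inr (Set.mem_iUnion.2 ⟨⟨k, hk.trans n.lt_succ_self⟩, .inr hx⟩)
      · exact .inr (Set.mem_iUnion.2 ⟨⟨k + 1, Nat.succ_lt_succ hk⟩, .inl hx⟩)
    · exact .inr (Set.mem_iUnion.2 ⟨⟨n, n.lt_succ_self⟩, .inr hx⟩)

theorem MutuallyIndiscernible.swap {N₁ N₂ : Type*} [LinearOrder N₁] [LinearOrder N₂]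
    {b₁ : N₁ → Fin m₁ → M} {b₂ : N₂ → Fin m₂ → M} (h : MutuallyIndiscernible L b₁ b₂) :
    MutuallyIndiscernible L b₂ b₁ := ⟨h.2, h.1⟩

theorem MutuallyIndiscernible.comp {N₁ N₂ P₁ P₂ : Type*} [LinearOrder N₁] [LinearOrder N₂]
    [LinearOrder P₁] [LinearOrder P₂] {b₁ : N₁ → Fin m₁ → M} {b₂ : N₂ → Fin m₂ → M}
    (h : MutuallyIndiscernible L b₁ b₂) {f : P₁ → N₁} {g : P₂ → N₂} (hf : StrictMono f)
    (hg : StrictMono g) :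
    MutuallyIndiscernible L (b₁ ∘ f) (b₂ ∘ g) :=
  mutuallyIndiscernible_iff.2 fun n l φ s s' t t' hs hs' ht ht' =>
    mutuallyIndiscernible_iff.1 h n l φ (f ∘ s) (f ∘ s') (g ∘ t) (g ∘ t') (hf.comp hs)
      (hf.comp hs') (hg.comp ht) (hg.comp ht')

theorem Perpendicular.symm (hM : IsMonster L T M κ) (hN : NIP L M)
    (h₁ : IsEndlessIndiscernible L κ a₁) (h₂ : IsEndlessIndiscernible L κ a₂)
    (h : Perpendicular L a₁ a₂) : Perpendicular L a₂ a₁ := by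
  obtain ⟨c₁, c₂, hc⟩ := exists_builtFromAverages hM h₁ h₂
  exact perpendicular_of_built hN h₂ h₁ hc.swap
    ((h c₁ c₂ hc).swap.comp (f := id) strictMono_id
      fun _ _ h => Nat.succ_lt_succ h)

/-! ### Equivalent sequences and unbounded subsequences -/

theorem Equivalent.symm {m : ℕ} {a₁ : I₁ → Fin m → M} {a₂ : I₂ → Fin m → M}
    (h : Equivalent L a₁ a₂) : Equivalent L a₂ a₁ := fun A => (h A).symm

theorem Equivalent.realizesAv {m : ℕ} {a₁ : I₁ → Fin m → M} {a₂ : I₂ → Fin m → M}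
    (h : Equivalent L a₁ a₂) {A : Set M} {b : Fin m → M} (hb : RealizesAv L A a₁ b) :
    RealizesAv L A a₂ b := fun φ hφ => hb φ (by rwa [h A])

/-- A pair built from `a₁`, `a₂` over the entries of all four sequences is also built from `a₃`,
`a₄`, and one pair decides perpendicularity. -/
theorem Perpendicular.of_equivalent {I₃ I₄ : Type w} [LinearOrder I₃] [LinearOrder I₄]
    {a₃ : I₃ → Fin m₁ → M} {a₄ : I₄ → Fin m₂ → M} (hM : IsMonster L T M κ) (hN : NIP L M)
    (h₁ : IsEndlessIndiscernible L κ a₁) (h₂ : IsEndlessIndiscernible L κ a₂)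
    (h₃ : IsEndlessIndiscernible L κ a₃) (h₄ : IsEndlessIndiscernible L κ a₄)
    (h₁₃ : Equivalent L a₁ a₃) (h₂₄ : Equivalent L a₂ a₄)
    (h : Perpendicular L a₁ a₂) : Perpendicular L a₃ a₄ := by
  have := hM.nonempty
  have := h₁.1
  have := h₂.1
  have hκ := hM.aleph0_lt
  obtain ⟨c₁, c₂, hc⟩ := exists_built hM.saturated hκ (A := entries a₃ ∪ entries a₄)
    ((mk_union_le _ _).trans_lt (add_lt_of_lt hκ.le (mk_entries_lt hκ h₃.2.2.1 a₃)
      (mk_entries_lt hκ h₄.2.2.1 a₄))) h₁.2.2.1 h₂.2.2.1 a₁ a₂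
  have hsub : ∀ n, base a₃ a₄ c₁ c₂ n ⊆ entries a₃ ∪ entries a₄ ∪ base a₁ a₂ c₁ c₂ n :=
    fun n => Set.union_subset_union_right _ Set.subset_union_right
  refine perpendicular_of_built hN h₃ h₄ (c₁ := c₁) (c₂ := c₂) (fun n => ⟨?_, ?_⟩)
    (h c₁ c₂ fun n => ⟨(hc n).1.mono Set.subset_union_right,
      (hc n).2.mono Set.subset_union_right⟩)
  · exact h₁₃.realizesAv ((hc n).1.mono (hsub n))
  · refine h₂₄.realizesAv ((hc n).2.mono ?_)
    rw [← Set.union_assoc]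
    exact Set.union_subset_union_left _ (hsub n)

theorem IsEndlessIndiscernible.restrict (h : IsEndlessIndiscernible L κ a₁) {J : Set I₁}
    (hJ : IsCofinal J) : IsEndlessIndiscernible L κ fun t : J => a₁ t := by
  obtain ⟨⟨x⟩, _, hI, ha⟩ := h
  refine ⟨?_, ⟨fun x => ?_⟩, (mk_set_le J).trans_lt hI, fun n φ s t hs ht =>
    ha n φ (fun i => s i) (fun i => t i) hs ht⟩
  · obtain ⟨y, hy, -⟩ := hJ x
    exact ⟨⟨y, hy⟩⟩
  · obtain ⟨y, hy⟩ := exists_gt (x : I₁)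
    obtain ⟨z, hz, hyz⟩ := hJ y
    exact ⟨⟨z, hz⟩, hy.trans_le hyz⟩

theorem equivalent_restrict (hN : NIP L M) (h : IsEndlessIndiscernible L κ a₁) {J : Set I₁}
    (hJ : IsCofinal J) : Equivalent L a₁ fun t : J => a₁ t := by
  obtain ⟨_, _, -⟩ := h.restrict hJ
  obtain ⟨_, _, hI, ha⟩ := h
  have key : ∀ P : I₁ → Prop, (∀ᶠ t in Filter.atTop, P t) → ∀ᶠ t : J in Filter.atTop, P t := by
    intro P hP
    obtain ⟨x, hx⟩ := Filter.eventually_atTop.1 hP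
    obtain ⟨y, hy, hxy⟩ := hJ x
    exact Filter.eventually_atTop.2 ⟨⟨y, hy⟩, fun z hz => hx z (hxy.trans hz)⟩
  intro A
  ext φ
  refine ⟨fun h => key _ h, fun h => ?_⟩
  -- By NIP the only alternative is that the negation holds eventually along `a₁`, hence also along
  -- the subsequence.
  refine (eventually_or hN ha φ (fun x : A => (x : M))).resolve_right fun h' => ?_
  obtain ⟨t, ht, ht'⟩ := (Filter.Eventually.and h (key _ h')).exists
  exact ht' ht

theorem perpendicular_restrict_iff (hM : IsMonster L T M κ) (hN : NIP L M)
    (h₁ : IsEndlessIndiscernible L κ a₁) (h₂ : IsEndlessIndiscernible L κ a₂) {J₁ : Set I₁}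
    {J₂ : Set I₂} (hJ₁ : IsCofinal J₁) (hJ₂ : IsCofinal J₂) :
    Perpendicular L a₁ a₂ ↔ Perpendicular L (fun t : J₁ => a₁ t) (fun t : J₂ => a₂ t) :=
  have e₁ := equivalent_restrict hN h₁ hJ₁
  have e₂ := equivalent_restrict hN h₂ hJ₂
  ⟨.of_equivalent hM hN h₁ h₂ (h₁.restrict hJ₁) (h₂.restrict hJ₂) e₁ e₂,
    .of_equivalent hM hN (h₁.restrict hJ₁) (h₂.restrict hJ₂) h₁ h₂ e₁.symm e₂.symm⟩

end perpendicular

/-! ### Different cofinalities -/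

theorem exists_forall_le_of_lt_cof {I : Type w} [LinearOrder I] {ι : Type v}
    (h : lift.{w} #ι < lift.{v} (Order.cof I)) (g : ι → I) : ∃ T, ∀ i, g i ≤ T := by
  by_contra! hcon
  have hg : IsCofinal (Set.range g) := fun T =>
    let ⟨i, hi⟩ := hcon T
    ⟨g i, ⟨i, rfl⟩, hi.le⟩
  exact h.not_ge ((lift_le.2 (Order.cof_le hg)).trans mk_range_le_lift)

theorem exists_strictMono_gt {I : Type*} [LinearOrder I] [NoMaxOrder I] (T : I) (n : ℕ) :
    ∃ t : Fin n → I, StrictMono t ∧ ∀ i, T < t i := by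
  obtain ⟨T', hT'⟩ := exists_gt T
  obtain ⟨f, hf, h0⟩ := Nat.exists_strictMono' T'
  exact ⟨fun i => f i, fun i j hij => hf hij, fun i =>
    hT'.trans_le (h0 ▸ hf.monotone (Nat.zero_le i))⟩

theorem noMaxOrder_of_aleph0_le_cof {I : Type*} [LinearOrder I] (h : ℵ₀ ≤ Order.cof I) :
    Nonempty I ∧ NoMaxOrder I := by
  have hI : Nonempty I := Order.cof_ne_zero_iff.1 (aleph0_pos.trans_le h).ne'
  have := Order.one_lt_cof_iff.1 (one_lt_aleph0.trans_le h)
  exact ⟨hI, noTopOrder_iff_noMaxOrder I |>.1 this⟩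

theorem mk_formula_le (L : FirstOrder.Language.{u, v}) (α : Type) [Countable α] :
    #(L.Formula α) ≤ theoryCard L := by
  have h : Function.Injective (fun φ : L.BoundedFormula α 0 =>
      (⟨0, φ⟩ : Σ n, L.BoundedFormula α n)) := fun φ ψ h => by simpa using h
  refine (mk_le_of_injective h).trans (BoundedFormula.card_le.trans ?_)
  refine max_le (le_max_left _ _) (add_le_of_le (le_max_left _ _) ?_ ?_)
  · refine le_trans ?_ (le_max_left _ _)
    rw [lift_le_aleph0]
    exact mk_le_aleph0
  · rw [lift_id']
    exact le_max_right _ _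

section

variable {I₁ I₂ : Type w} [LinearOrder I₁] [LinearOrder I₂]
  {m₁ m₂ : ℕ} {a₁ : I₁ → Fin m₁ → M} {a₂ : I₂ → Fin m₂ → M}

/-- If the cofinality of the second index set exceeds the size of the first, each formula has a
constant truth value on pairs of increasing tuples from some end segments. -/
theorem exists_forall_realize_iff (hN : NIP L M) [Nonempty I₁] [NoMaxOrder I₁] [Nonempty I₂]
    [NoMaxOrder I₂] (ha₁ : IndiscernibleOver L ∅ a₁) (ha₂ : IndiscernibleOver L ∅ a₂)
    (hI : #I₁ < Order.cof I₂) {n l : ℕ} (φ : L.Formula ((Fin n × Fin m₁) ⊕ (Fin l × Fin m₂))) :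
    ∃ (T₁ : I₁) (T₂ : I₂), ∀ (s s' : Fin n → I₁) (t t' : Fin l → I₂), StrictMono s →
      StrictMono s' → StrictMono t → StrictMono t' → (∀ i, T₁ < s i) → (∀ i, T₁ < s' i) →
      (∀ i, T₂ < t i) → (∀ i, T₂ < t' i) →
      (φ.Realize (pairVal (a₁ ∘ s) (a₂ ∘ t)) ↔ φ.Realize (pairVal (a₁ ∘ s') (a₂ ∘ t'))) := by
  have hinf : Infinite I₁ := NoMaxOrder.infinite
  -- Each tuple `s` from `I₁` has a threshold `g s` in `I₂`. There are at most `#I₁ < cof I₂` such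
  -- tuples, so `T₂` bounds all thresholds.
  have h1 := fun s : Fin n → I₁ =>
    eventually_const hN ha₂ φ (fun p : Fin n × Fin m₁ => a₁ (s p.1) p.2)
  choose g hg using h1
  have hcard : #(Fin n → I₁) < Order.cof I₂ := by
    refine lt_of_le_of_lt ?_ hI
    simpa using power_nat_le (n := n) (aleph0_le_mk I₁)
  obtain ⟨T₂, hT₂⟩ := exists_forall_le_of_lt_cof (lift_lt.2 hcard) g
  -- Beyond `T₂` the choice of `t` is immaterial, so one fixed `t₀` serves as the parameters
  -- determining `T₁`.
  obtain ⟨t₀, ht₀, hTt₀⟩ := exists_strictMono_gt T₂ l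
  obtain ⟨T₁, hT₁⟩ := eventually_const hN ha₁ (φ.relabel Sum.swap)
    (fun p : Fin l × Fin m₂ => a₂ (t₀ p.1) p.2)
  have key : ∀ (s : Fin n → I₁) (t t' : Fin l → I₂), StrictMono t → StrictMono t' →
      (∀ i, T₂ < t i) → (∀ i, T₂ < t' i) →
      (φ.Realize (pairVal (a₁ ∘ s) (a₂ ∘ t)) ↔ φ.Realize (pairVal (a₁ ∘ s) (a₂ ∘ t'))) :=
    fun s t t' ht ht' hTt hTt' => hg s t t' ht ht' (fun i => (hT₂ s).trans_lt (hTt i))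
      fun i => (hT₂ s).trans_lt (hTt' i)
  refine ⟨T₁, T₂, fun s s' t t' hs hs' ht ht' hTs hTs' hTt hTt' => ?_⟩
  rw [key s t t₀ ht ht₀ hTt hTt₀, key s' t' t₀ ht' ht₀ hTt' hTt₀,
    ← realize_pairVal_swap φ, ← realize_pairVal_swap φ (a₁ ∘ s')]
  exact hT₁ s s' hs hs' hTs hTs'

/-- The thresholds for single formulas are bounded in two stages, over the at most `|T|` formulas of
each shape and then over the countably many shapes `(n, l)`. Both cofinalities exceed `|T|`. -/
theorem exists_mutuallyIndiscernible_endSegments (hN : NIP L M)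
    (ha₁ : IndiscernibleOver L ∅ a₁) (ha₂ : IndiscernibleOver L ∅ a₂)
    (hT : lift.{w} (theoryCard L) < lift.{max u v} (Order.cof I₁)) (hI : #I₁ < Order.cof I₂) :
    ∃ (J₁ : Set I₁) (J₂ : Set I₂), IsEndSegment J₁ ∧ IsEndSegment J₂ ∧
      MutuallyIndiscernible L (fun t : J₁ => a₁ t) (fun t : J₂ => a₂ t) := by
  have hI' : Order.cof I₁ ≤ Order.cof I₂ := (Order.cof_le_cardinalMk I₁).trans hI.le
  have h0 : ℵ₀ < Order.cof I₁ := by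
    have := (lift_le.2 (le_max_left ℵ₀ L.card)).trans_lt hT
    rwa [lift_aleph0, ← lift_aleph0.{max u v, w}, lift_lt] at this
  obtain ⟨_, _⟩ := noMaxOrder_of_aleph0_le_cof h0.le
  obtain ⟨_, _⟩ := noMaxOrder_of_aleph0_le_cof (h0.le.trans hI')
  choose T₁ T₂ h using fun p : ℕ × ℕ =>
    exists_forall_realize_iff (n := p.1) (l := p.2) hN ha₁ ha₂ hI
  have hF : ∀ p : ℕ × ℕ,
      lift.{w} #(L.Formula ((Fin p.1 × Fin m₁) ⊕ (Fin p.2 × Fin m₂))) <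
        lift.{max u v} (Order.cof I₁) := fun p =>
    (lift_le.2 (mk_formula_le L _)).trans_lt hT
  have hω : lift.{w} #(ℕ × ℕ) < lift.{0} (Order.cof I₁) := by simpa using h0
  choose S₁ hS₁ using fun p => exists_forall_le_of_lt_cof (hF p) (T₁ p)
  choose S₂ hS₂ using fun p =>
    exists_forall_le_of_lt_cof ((hF p).trans_le (lift_le.2 hI')) (T₂ p)
  obtain ⟨R₁, hR₁⟩ := exists_forall_le_of_lt_cof hω S₁
  obtain ⟨R₂, hR₂⟩ := exists_forall_le_of_lt_cof (hω.trans_le (lift_le.2 hI')) S₂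
  refine ⟨Set.Ioi R₁, Set.Ioi R₂, ⟨Set.nonempty_Ioi, isUpperSet_Ioi _⟩,
    ⟨Set.nonempty_Ioi, isUpperSet_Ioi _⟩, ?_⟩
  refine mutuallyIndiscernible_iff.2 fun n l φ s s' t t' hs hs' ht ht' => ?_
  have h₁ : T₁ (n, l) φ ≤ R₁ := (hS₁ _ _).trans (hR₁ (n, l))
  have h₂ : T₂ (n, l) φ ≤ R₂ := (hS₂ _ _).trans (hR₂ (n, l))
  exact h (n, l) φ (fun i => s i) (fun i => s' i) (fun i => t i) (fun i => t' i) hs hs' ht ht'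
    (fun i => h₁.trans_lt (s i).2) (fun i => h₁.trans_lt (s' i).2)
    (fun i => h₂.trans_lt (t i).2) fun i => h₂.trans_lt (t' i).2

/-- The substituted members can be taken beyond thresholds depending on the formula, so no uniform
end segments, and no comparison with `|T|`, are needed. -/
theorem perpendicular_of_mk_lt_cof (hN : NIP L M) [Nonempty I₁] [NoMaxOrder I₁] [Nonempty I₂]
    [NoMaxOrder I₂] (ha₁ : IndiscernibleOver L ∅ a₁) (ha₂ : IndiscernibleOver L ∅ a₂)
    (hI : #I₁ < Order.cof I₂) : Perpendicular L a₁ a₂ := by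
  intro b₁ b₂ hb
  refine mutuallyIndiscernible_iff.2 fun n l φ s s' t t' hs hs' ht ht' => ?_
  obtain ⟨T₁, T₂, hT⟩ := exists_forall_realize_iff hN ha₁ ha₂ hI
    (φ.relabel (Sum.map (Prod.map Fin.rev id) (Prod.map Fin.rev id)))
  obtain ⟨σ, τ, hσ, hτ, h1, h2, e⟩ := hb.exists_realize_iff hN ha₁ ha₂ φ hs ht T₁ T₂
  obtain ⟨σ', τ', hσ', hτ', h1', h2', e'⟩ := hb.exists_realize_iff hN ha₁ ha₂ φ hs' ht' T₁ T₂
  rw [e, e', ← realize_pairVal_rev φ, ← realize_pairVal_rev φ (a₁ ∘ σ')]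
  exact hT _ _ _ _ (strictMono_comp_rev hσ) (strictMono_comp_rev hσ') (strictMono_comp_rev hτ)
    (strictMono_comp_rev hτ') (fun i => h1 _) (fun i => h1' _) (fun i => h2 _) fun i => h2' _

variable {T : L.Theory} {κ : Cardinal.{w}}

/-- Thinning `I₁` to a cofinal subset of least size preserves perpendicularity and turns its
cofinality into its cardinality. -/
theorem perpendicular_of_cof_lt_cof (hM : IsMonster L T M κ) (hN : NIP L M)
    (h₁ : IsEndlessIndiscernible L κ a₁) (h₂ : IsEndlessIndiscernible L κ a₂)
    (h : Order.cof I₁ < Order.cof I₂) : Perpendicular L a₁ a₂ := by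
  obtain ⟨J, hJ, hJc⟩ := Order.exists_cof_eq I₁
  have hu : IsCofinal (Set.univ : Set I₂) := fun x => ⟨x, trivial, le_rfl⟩
  rw [perpendicular_restrict_iff hM hN h₁ h₂ hJ hu]
  obtain ⟨_, _, -, h₁⟩ := h₁.restrict hJ
  obtain ⟨_, _, -, h₂⟩ := h₂.restrict hu
  exact perpendicular_of_mk_lt_cof hN h₁ h₂ (by rwa [hJc, Order.cof_eq_of_isCofinal hu])

theorem perpendicular_of_cof_ne_cof (hM : IsMonster L T M κ) (hN : NIP L M)
    (h₁ : IsIndiscernibleSeq L κ a₁) (h₂ : IsIndiscernibleSeq L κ a₂)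
    (hc₁ : ℵ₀ ≤ Order.cof I₁) (hc₂ : ℵ₀ ≤ Order.cof I₂) (h : Order.cof I₁ ≠ Order.cof I₂) :
    Perpendicular L a₁ a₂ := by
  have e₁ : IsEndlessIndiscernible L κ a₁ :=
    ⟨(noMaxOrder_of_aleph0_le_cof hc₁).1, (noMaxOrder_of_aleph0_le_cof hc₁).2, h₁⟩
  have e₂ : IsEndlessIndiscernible L κ a₂ :=
    ⟨(noMaxOrder_of_aleph0_le_cof hc₂).1, (noMaxOrder_of_aleph0_le_cof hc₂).2, h₂⟩
  rcases h.lt_or_gt with h | h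
  · exact perpendicular_of_cof_lt_cof hM hN e₁ e₂ h
  · exact (perpendicular_of_cof_lt_cof hM hN e₂ e₁ h).symm hM hN e₂ e₁

/-! ### Sequences of averages over both sequences -/

theorem exists_nat_same_order {N : Type*} [LinearOrder N] {n l : ℕ} {s : Fin n → N}
    {t : Fin l → N} (hs : StrictMono s) (ht : StrictMono t) :
    ∃ (s' : Fin n → ℕ) (t' : Fin l → ℕ), StrictMono s' ∧ StrictMono t' ∧
      ∀ i j, s i ≤ t j ↔ s' i ≤ t' j := by
  classical
  let V : Finset N := Finset.univ.image s ∪ Finset.univ.image t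
  have hsV : ∀ i, s i ∈ V := fun i =>
    Finset.mem_union_left _ (Finset.mem_image_of_mem _ (Finset.mem_univ _))
  have htV : ∀ i, t i ∈ V := fun i =>
    Finset.mem_union_right _ (Finset.mem_image_of_mem _ (Finset.mem_univ _))
  let e := V.orderIsoOfFin rfl
  exact ⟨fun i => e.symm ⟨s i, hsV i⟩, fun j => e.symm ⟨t j, htV j⟩,
    fun i j hij => e.symm.strictMono (a := ⟨s i, hsV i⟩) (b := ⟨s j, hsV j⟩) (hs hij),
    fun i j hij => e.symm.strictMono (a := ⟨t i, htV i⟩) (b := ⟨t j, htV j⟩) (ht hij),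
    fun i j => (e.symm.le_iff_le (x := ⟨s i, hsV i⟩) (y := ⟨t j, htV j⟩)).symm⟩

/-- Every finite configuration of indices in `N` has a copy in `ℕ`, and only the relative order
matters. -/
theorem BuiltFromAverages.mutuallyIndiscernible_of_nat (hN : NIP L M)
    [Nonempty I₁] [NoMaxOrder I₁] [Nonempty I₂] [NoMaxOrder I₂]
    (ha₁ : IndiscernibleOver L ∅ a₁) (ha₂ : IndiscernibleOver L ∅ a₂)
    {N : Type*} [LinearOrder N] {b₁ : N → Fin m₁ → M} {b₂ : N → Fin m₂ → M}
    (hb : BuiltFromAverages L a₁ a₂ b₁ b₂) {c₁ : ℕ → Fin m₁ → M} {c₂ : ℕ → Fin m₂ → M}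
    (hc : BuiltFromAverages L a₁ a₂ c₁ c₂) (hmi : MutuallyIndiscernible L c₁ c₂) :
    MutuallyIndiscernible L b₁ b₂ := by
  refine mutuallyIndiscernible_iff.2 fun n l φ s s' t t' hs hs' ht ht' => ?_
  obtain ⟨σ, τ, hσ, hτ, h⟩ := exists_nat_same_order hs ht
  obtain ⟨σ', τ', hσ', hτ', h'⟩ := exists_nat_same_order hs' ht'
  rw [hb.realize_iff hN ha₁ ha₂ hc φ hs ht hσ hτ h,
    hb.realize_iff hN ha₁ ha₂ hc φ hs' ht' hσ' hτ' h']
  exact mutuallyIndiscernible_iff.1 hmi n l φ σ σ' τ τ' hσ hσ' hτ hτ'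

/-- Sequences built from averages of `b₁`, `b₂`, read backwards, have the type of sequences built
from averages of `a₁`, `a₂`. -/
theorem BuiltFromAverages.realize_iff_reverse (hN : NIP L M)
    [Nonempty I₁] [NoMaxOrder I₁] [Nonempty I₂] [NoMaxOrder I₂]
    (ha₁ : IndiscernibleOver L ∅ a₁) (ha₂ : IndiscernibleOver L ∅ a₂)
    {N : Type w} [LinearOrder N] [Nonempty N] [NoMaxOrder N]
    {b₁ : N → Fin m₁ → M} {b₂ : N → Fin m₂ → M}
    (hb : BuiltFromAverages L a₁ a₂ b₁ b₂) {c₁ d₁ : ℕ → Fin m₁ → M} {c₂ d₂ : ℕ → Fin m₂ → M}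
    (hc : BuiltFromAverages L a₁ a₂ c₁ c₂) (hd : BuiltFromAverages L b₁ b₂ d₁ d₂)
    {n l : ℕ} (φ : L.Formula ((Fin n × Fin m₁) ⊕ (Fin l × Fin m₂))) {s : Fin n → ℕ}
    {t : Fin l → ℕ} (hs : StrictMono s) (ht : StrictMono t) {k : ℕ} (hsk : ∀ i, s i ≤ k)
    (htk : ∀ i, t i ≤ k) :
    φ.Realize (pairVal (c₁ ∘ s) (c₂ ∘ t)) ↔
      φ.Realize (pairVal (d₁ ∘ fun i => k + 1 - s i) (d₂ ∘ fun i => k - t i)) := by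
  have hb₁ := hb.indiscernible_left hN ha₁ ha₂
  have hb₂ := hb.indiscernible_right hN ha₁ ha₂
  have hs' : Function.Injective fun i => k + 1 - s i := fun i j hij => hs.injective (by
    have := hsk i; have := hsk j; dsimp only at hij; omega)
  have ht' : Function.Injective fun i => k - t i := fun i j hij => ht.injective (by
    have := htk i; have := htk j; dsimp only at hij; omega)
  -- Reversing the construction puts `d₂ p` before `d₁ p`, whereas `c₁` precedes `c₂` at equal
  -- index. The shift in `k + 1 - s i` corrects this: `d₂ (k - t j)` is chosen before `d₁ (k + 1 - s
  -- i)` exactly when `s i ≤ t j`. Substitution reverses the order once more, and the strict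
  -- relations passed to it keep track of the order between the two sequences.
  have g := hd.genericOver (fun i => k + 1 - s i) (fun i => k - t i)
  obtain ⟨σ, τ, -, -, h1, h2, h3, h4, e, -⟩ := g.exists_realize_iff hN hb₁ hb₂
    Set.subset_union_left Set.subset_union_right Set.subset_union_left Set.subset_union_right
    (rank_injective hs' ht') g φ (Classical.arbitrary N) (Classical.arbitrary N)
    (fun x y => x < y) (fun x y => x < y) Filter.eventually_gt_atTop Filter.eventually_gt_atTop
  have hσ : StrictMono σ := fun i j hij => h1 j i (by
    have := hsk i; have := hsk j; have := hs hij
    simp only [Prod.Lex.toLex_lt_toLex]; omega)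
  have hτ : StrictMono τ := fun i j hij => h2 j i (by
    have := htk i; have := htk j; have := ht hij
    simp only [Prod.Lex.toLex_lt_toLex]; omega)
  rw [e]
  refine hc.realize_iff hN ha₁ ha₂ hb φ hs ht hσ hτ fun i j => ?_
  have := hsk i
  have := htk j
  rcases le_or_gt (s i) (t j) with h | h
  · exact iff_of_true h (h3 i j (by simp only [Prod.Lex.toLex_lt_toLex]; omega)).le
  · refine iff_of_false h.not_ge (h4 i j ?_).not_ge
    have h5 : k + 1 - s i ≤ k - t j := by omega
    simpa [Prod.Lex.toLex_lt_toLex, ← le_iff_lt_or_eq] using h5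

theorem perpendicular_iff_of_builtFromAverages (hM : IsMonster L T M κ) (hN : NIP L M)
    (h₁ : IsEndlessIndiscernible L κ a₁) (h₂ : IsEndlessIndiscernible L κ a₂)
    {N : Type w} [LinearOrder N] [Nonempty N] [NoMaxOrder N] (hNκ : #N < κ)
    {b₁ : N → Fin m₁ → M} {b₂ : N → Fin m₂ → M} (hb : BuiltFromAverages L a₁ a₂ b₁ b₂) :
    IsEndlessIndiscernible L κ b₁ ∧ IsEndlessIndiscernible L κ b₂ ∧
      (Perpendicular L a₁ a₂ ↔ Perpendicular L b₁ b₂) := by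
  obtain ⟨c₁, c₂, hc⟩ := exists_builtFromAverages hM h₁ h₂
  have e₁ := h₁
  have e₂ := h₂
  obtain ⟨_, _, _, ha₁⟩ := h₁
  obtain ⟨_, _, _, ha₂⟩ := h₂
  have hb₁ : IsEndlessIndiscernible L κ b₁ :=
    ⟨inferInstance, inferInstance, hNκ, hb.indiscernible_left hN ha₁ ha₂⟩
  have hb₂ : IsEndlessIndiscernible L κ b₂ :=
    ⟨inferInstance, inferInstance, hNκ, hb.indiscernible_right hN ha₁ ha₂⟩
  refine ⟨hb₁, hb₂, fun h => ?_, fun h => ?_⟩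
  -- Perpendicularity makes `b₁`, `b₂` themselves mutually indiscernible, hence perpendicular.
  · exact (hb.mutuallyIndiscernible_of_nat hN ha₁ ha₂ hc (h c₁ c₂ hc)).perpendicular hN hb₁ hb₂
  · obtain ⟨d₁, d₂, hd⟩ := exists_builtFromAverages hM hb₁ hb₂
    refine perpendicular_of_built hN e₁ e₂ hc
      (mutuallyIndiscernible_iff.2 fun n l φ s s' t t' hs hs' ht ht' => ?_)
    have bdd : ∀ {q : ℕ} (x : Fin q → ℕ), ∃ k, ∀ i, x i ≤ k := fun x => by
      obtain ⟨k, hk⟩ := (Set.finite_range x).bddAbove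
      exact ⟨k, fun i => hk ⟨i, rfl⟩⟩
    obtain ⟨k₁, hk₁⟩ := bdd s
    obtain ⟨k₂, hk₂⟩ := bdd s'
    obtain ⟨k₃, hk₃⟩ := bdd t
    obtain ⟨k₄, hk₄⟩ := bdd t'
    -- The upper bound keeps natural subtraction from truncating, which would destroy strictness.
    have anti : ∀ {q : ℕ} {x : Fin q → ℕ} (r K : ℕ), StrictMono x → (∀ i, x i ≤ r) → r ≤ K →
        StrictAnti fun i => K - x i := fun r K hx hr hK i j hij => by
      have := hx hij; have := hr i; have := hr j; dsimp only; omega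
    set k := k₁ + k₂ + k₃ + k₄ with hk
    rw [hb.realize_iff_reverse hN ha₁ ha₂ hc hd φ hs ht (k := k)
        (fun i => (hk₁ i).trans (by omega)) fun i => (hk₃ i).trans (by omega),
      hb.realize_iff_reverse hN ha₁ ha₂ hc hd φ hs' ht' (k := k)
        (fun i => (hk₂ i).trans (by omega)) fun i => (hk₄ i).trans (by omega)]
    exact (h d₁ d₂ hd).realize_iff_of_strictAnti φ (anti k₁ _ hs hk₁ (by omega))
      (anti k₂ _ hs' hk₂ (by omega)) (anti k₃ _ ht hk₃ (by omega)) (anti k₄ _ ht' hk₄ (by omega))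

end

end

end NIPSeq

theorem claim4p3 (L : FirstOrder.Language.{u, v}) (T : L.Theory) (M : Type w) [L.Structure M]
    (κ : Cardinal.{w}) (hM : NIPSeq.IsMonster L T M κ) (hNIP : NIPSeq.NIP L M) :
    -- endless mutually indiscernible sequences are perpendicular
    (∀ (I₁ I₂ : Type w) [LinearOrder I₁] [LinearOrder I₂] (m₁ m₂ : ℕ)
      (a₁ : I₁ → Fin m₁ → M) (a₂ : I₂ → Fin m₂ → M),
      NIPSeq.IsEndlessIndiscernible L κ a₁ → NIPSeq.IsEndlessIndiscernible L κ a₂ →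
      NIPSeq.MutuallyIndiscernible L a₁ a₂ → NIPSeq.Perpendicular L a₁ a₂) ∧
    -- mutual indiscernibility is symmetric
    (∀ (I₁ I₂ : Type w) [LinearOrder I₁] [LinearOrder I₂] (m₁ m₂ : ℕ)
      (a₁ : I₁ → Fin m₁ → M) (a₂ : I₂ → Fin m₂ → M),
      NIPSeq.MutuallyIndiscernible L a₁ a₂ → NIPSeq.MutuallyIndiscernible L a₂ a₁) ∧
    -- perpendicularity is symmetric
    (∀ (I₁ I₂ : Type w) [LinearOrder I₁] [LinearOrder I₂] (m₁ m₂ : ℕ)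
      (a₁ : I₁ → Fin m₁ → M) (a₂ : I₂ → Fin m₂ → M),
      NIPSeq.IsEndlessIndiscernible L κ a₁ → NIPSeq.IsEndlessIndiscernible L κ a₂ →
      NIPSeq.Perpendicular L a₁ a₂ → NIPSeq.Perpendicular L a₂ a₁) ∧
    -- equivalence of endless indiscernible sequences is an equivalence relation
    (∀ (I₁ I₂ I₃ : Type w) [LinearOrder I₁] [LinearOrder I₂] [LinearOrder I₃] (m : ℕ)
      (a₁ : I₁ → Fin m → M) (a₂ : I₂ → Fin m → M) (a₃ : I₃ → Fin m → M),
      NIPSeq.IsEndlessIndiscernible L κ a₁ → NIPSeq.IsEndlessIndiscernible L κ a₂ →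
      NIPSeq.IsEndlessIndiscernible L κ a₃ →
      NIPSeq.Equivalent L a₁ a₁ ∧
      (NIPSeq.Equivalent L a₁ a₂ → NIPSeq.Equivalent L a₂ a₁) ∧
      (NIPSeq.Equivalent L a₁ a₂ → NIPSeq.Equivalent L a₂ a₃ → NIPSeq.Equivalent L a₁ a₃)) ∧
    -- mutually indiscernible end segments
    (∀ (I₁ I₂ : Type w) [LinearOrder I₁] [LinearOrder I₂] (m₁ m₂ : ℕ)
      (a₁ : I₁ → Fin m₁ → M) (a₂ : I₂ → Fin m₂ → M),
      NIPSeq.IsIndiscernibleSeq L κ a₁ → NIPSeq.IsIndiscernibleSeq L κ a₂ →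
      lift.{w} (NIPSeq.theoryCard L) < lift.{max u v} (Order.cof I₁) → #I₁ < Order.cof I₂ →
      ∃ (J₁ : Set I₁) (J₂ : Set I₂), NIPSeq.IsEndSegment J₁ ∧ NIPSeq.IsEndSegment J₂ ∧
        NIPSeq.MutuallyIndiscernible L (fun t : J₁ => a₁ t) (fun t : J₂ => a₂ t)) ∧
    -- distinct infinite cofinalities
    (∀ (I₁ I₂ : Type w) [LinearOrder I₁] [LinearOrder I₂] (m₁ m₂ : ℕ)
      (a₁ : I₁ → Fin m₁ → M) (a₂ : I₂ → Fin m₂ → M),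
      NIPSeq.IsIndiscernibleSeq L κ a₁ → NIPSeq.IsIndiscernibleSeq L κ a₂ →
      ℵ₀ ≤ Order.cof I₁ → ℵ₀ ≤ Order.cof I₂ → Order.cof I₁ ≠ Order.cof I₂ →
      NIPSeq.Perpendicular L a₁ a₂) ∧
    -- sequences of averages built over both, of length a limit ordinal
    (∀ (I₁ I₂ : Type w) [LinearOrder I₁] [LinearOrder I₂] (m₁ m₂ : ℕ)
      (a₁ : I₁ → Fin m₁ → M) (a₂ : I₂ → Fin m₂ → M) (δ : Ordinal.{w})
      (b₁ : δ.ToType → Fin m₁ → M) (b₂ : δ.ToType → Fin m₂ → M),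
      NIPSeq.IsEndlessIndiscernible L κ a₁ → NIPSeq.IsEndlessIndiscernible L κ a₂ →
      Order.IsSuccLimit δ → δ.card < κ → NIPSeq.BuiltFromAverages L a₁ a₂ b₁ b₂ →
      NIPSeq.IsEndlessIndiscernible L κ b₁ ∧ NIPSeq.IsEndlessIndiscernible L κ b₂ ∧
      (NIPSeq.Perpendicular L a₁ a₂ ↔ NIPSeq.Perpendicular L b₁ b₂)) ∧
    -- unbounded subsequences
    (∀ (I₁ I₂ : Type w) [LinearOrder I₁] [LinearOrder I₂] (m₁ m₂ : ℕ)
      (a₁ : I₁ → Fin m₁ → M) (a₂ : I₂ → Fin m₂ → M) (J₁ : Set I₁) (J₂ : Set I₂),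
      NIPSeq.IsEndlessIndiscernible L κ a₁ → NIPSeq.IsEndlessIndiscernible L κ a₂ →
      IsCofinal J₁ → IsCofinal J₂ →
      (NIPSeq.Perpendicular L a₁ a₂ ↔
        NIPSeq.Perpendicular L (fun t : J₁ => a₁ t) (fun t : J₂ => a₂ t))) ∧
    -- equivalent sequences
    (∀ (I₁ I₂ I₃ I₄ : Type w) [LinearOrder I₁] [LinearOrder I₂] [LinearOrder I₃] [LinearOrder I₄]
      (m₁ m₂ : ℕ) (a₁ : I₁ → Fin m₁ → M) (a₂ : I₂ → Fin m₂ → M)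
      (a₃ : I₃ → Fin m₁ → M) (a₄ : I₄ → Fin m₂ → M),
      NIPSeq.IsEndlessIndiscernible L κ a₁ → NIPSeq.IsEndlessIndiscernible L κ a₂ →
      NIPSeq.IsEndlessIndiscernible L κ a₃ → NIPSeq.IsEndlessIndiscernible L κ a₄ →
      NIPSeq.Equivalent L a₁ a₃ → NIPSeq.Equivalent L a₂ a₄ →
      (NIPSeq.Perpendicular L a₁ a₂ ↔ NIPSeq.Perpendicular L a₃ a₄)) := by
  refine ⟨?_, ?_, ?_, ?_, ?_, ?_, ?_, ?_, ?_⟩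
  · intro I₁ I₂ _ _ m₁ m₂ a₁ a₂ h₁ h₂ h
    exact h.perpendicular hNIP h₁ h₂
  · intro I₁ I₂ _ _ m₁ m₂ a₁ a₂ h
    exact h.swap
  · intro I₁ I₂ _ _ m₁ m₂ a₁ a₂ h₁ h₂ h
    exact h.symm hM hNIP h₁ h₂
  · intro I₁ I₂ I₃ _ _ _ m a₁ a₂ a₃ _ _ _
    exact ⟨fun _ => rfl, fun h => h.symm, fun h h' A => (h A).trans (h' A)⟩
  · intro I₁ I₂ _ _ m₁ m₂ a₁ a₂ h₁ h₂ hT hI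
    exact NIPSeq.exists_mutuallyIndiscernible_endSegments hNIP h₁.2 h₂.2 hT hI
  · intro I₁ I₂ _ _ m₁ m₂ a₁ a₂ h₁ h₂ hc₁ hc₂ h
    exact NIPSeq.perpendicular_of_cof_ne_cof hM hNIP h₁ h₂ hc₁ hc₂ h
  · intro I₁ I₂ _ _ m₁ m₂ a₁ a₂ δ b₁ b₂ h₁ h₂ hδ hδκ hb
    have : Nonempty δ.ToType := Ordinal.nonempty_toType_iff.2 hδ.bot_lt.ne'
    have : NoMaxOrder δ.ToType := Ordinal.isSuccPrelimit_type_lt_iff.1 (by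
      rw [Ordinal.type_toType]
      exact hδ.isSuccPrelimit)
    exact NIPSeq.perpendicular_iff_of_builtFromAverages hM hNIP h₁ h₂
      (by rwa [Cardinal.mk_toType]) hb
  · intro I₁ I₂ _ _ m₁ m₂ a₁ a₂ J₁ J₂ h₁ h₂ hJ₁ hJ₂
    exact NIPSeq.perpendicular_restrict_iff hM hNIP h₁ h₂ hJ₁ hJ₂
  · intro I₁ I₂ I₃ I₄ _ _ _ _ m₁ m₂ a₁ a₂ a₃ a₄ h₁ h₂ h₃ h₄ h₁₃ h₂₄
    exact ⟨.of_equivalent hM hNIP h₁ h₂ h₃ h₄ h₁₃ h₂₄,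
      .of_equivalent hM hNIP h₃ h₄ h₁ h₂ h₁₃.symm h₂₄.symm⟩
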